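/- For a function $\alpha$ on $\mathbb{R}^3$ let $\hat\alpha(p)=(2\pi)^{-3/2}\int_{\mathbb{R}^3}\alpha(x)e^{-ip\cdot x}\,dx$ denote its Fourier transform (extended to $L^2$). Let $\mathcal{D}$ be the set of pairs $(\gamma,\alpha)$ with $\gamma\in L^1(\mathbb{R}^3,(1+p^2)\,dp)$, $0\le\gamma\le 1$, and $\alpha\in H^1(\mathbb{R}^3)$ complex-valued, such that $|\hat\alpha(p)|^2\le\gamma(p)(1-\gamma(p))$ for almost every $p$. Let $V\in L^{3/2}(\mathbb{R}^3)$ be real-valued, $\mu\in\mathbb{R}$, and $T=1/\beta\in[0,\infty)$ (with $\beta=\infty$ if $T=0$). For $(\gamma,\alpha)\in\mathcal{D}$ put $$\mathcal{F}_\beta(\gamma,\alpha)=\int_{\mathbb{R}^3}(p^2-\mu)\gamma(p)\,dp+\int_{\mathbb{R}^3}|\alpha(x)|^2V(x)\,dx-T\,S(\gamma,\alpha),$$ $$S(\gamma,\alpha)=-\int_{\mathbb{R}^3}\bigl[s(p)\ln s(p)+(1-s(p))\ln(1-s(p))\bigr]\,dp,$$ where $s(p)$ is determined by $s(1-s)=\gamma(1-\gamma)-|\hat\alpha|^2$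 (the two solutions $s$ and $1-s$ give the same integrand). **Proposition.** The three integrals above converge absolutely for every $(\gamma,\alpha)\in\mathcal{D}$, and $\mathcal{F}_\beta$ has a minimizer in $\mathcal{D}$: there is $(\tilde\gamma,\tilde\alpha)\in\mathcal{D}$ with $\mathcal{F}_\beta(\tilde\gamma,\tilde\alpha)\le\mathcal{F}_\beta(\gamma,\alpha)$ for all $(\gamma,\alpha)\in\mathcal{D}$. -/

import Mathlib

open MeasureTheory
open scoped FourierTransform SchwartzMap ENNReal

noncomputable section

namespace BCS

/-- Three-dimensional Euclidean space, used both for positions and for momenta. -/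
abbrev R3 : Type := EuclideanSpace ℝ (Fin 3)

/-- The space `L²(ℝ³; ℂ)` with respect to Lebesgue measure. -/
abbrev L2 : Type := Lp ℂ 2 (volume : Measure R3)

/-- The Fourier transform on `L²(ℝ³)` in the normalization
`α̂(p) = (2π)^(-3/2) ∫ α(x) e^{-i p·x} dx`. Mathlib's (unitary) Fourier transform on `L²` is the
extension of `𝓕 α (ξ) = ∫ α(x) e^{-2π i ξ·x} dx`, so that `α̂(p) = (2π)^(-3/2) 𝓕 α (p / (2π))`. -/
def hat (α : L2) (p : R3) : ℂ :=
  (((2 * Real.pi) ^ (-(3 / 2) : ℝ) : ℝ) : ℂ) * (𝓕 α : L2) ((2 * Real.pi)⁻¹ • p)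

/-- The admissible set of pairs `(γ, α)`: `γ ∈ L¹(ℝ³, (1 + p²) dp)` with `0 ≤ γ ≤ 1`,
`α ∈ H¹(ℝ³)` and `|α̂(p)|² ≤ γ(p) (1 - γ(p))`, the pointwise relations being understood
almost everywhere. -/
def admissible : Set ((R3 → ℝ) × L2) :=
  {x | Integrable (fun p => (1 + ‖p‖ ^ 2) * x.1 p) ∧
    (∀ᵐ p, 0 ≤ x.1 p ∧ x.1 p ≤ 1) ∧
    TemperedDistribution.MemSobolev 1 2 (x.2 : 𝓢'(R3, ℂ)) ∧
    ∀ᵐ p, ‖hat x.2 p‖ ^ 2 ≤ x.1 p * (1 - x.1 p)}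

/-- The smaller solution `s` of `s (1 - s) = y`, for `0 ≤ y ≤ 1/4`. -/
def root (y : ℝ) : ℝ := (1 - Real.sqrt (1 - 4 * y)) / 2

theorem root_spec {y : ℝ} (hy : y ≤ 1 / 4) : root y * (1 - root y) = y := by
  have h := Real.mul_self_sqrt (show (0 : ℝ) ≤ 1 - 4 * y by linarith)
  unfold root
  linear_combination -h / 4

/-- The entropy density `-(s ln s + (1 - s) ln (1 - s))`, with `0 ln 0 = 0`. -/
def entropyFn (s : ℝ) : ℝ := -(s * Real.log s + (1 - s) * Real.log (1 - s))

/-- The entropy density does not depend on which solution of `s (1 - s) = y` is chosen. -/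
theorem entropyFn_root {s y : ℝ} (h : s * (1 - s) = y) : entropyFn s = entropyFn (root y) := by
  have hy : y ≤ 1 / 4 := by nlinarith [sq_nonneg (s - 1 / 2)]
  have h2 : (s - root y) * (s - (1 - root y)) = 0 := by
    linear_combination -h + root_spec hy
  rcases mul_eq_zero.mp h2 with h3 | h3
  · rw [sub_eq_zero.mp h3]
  · rw [sub_eq_zero.mp h3]
    unfold entropyFn
    rw [sub_sub_cancel]
    ring

/-- The function `s(p)` determined by `s (1 - s) = γ (1 - γ) - |α̂|²`. -/
def sFn (γ : R3 → ℝ) (α : L2) (p : R3) : ℝ :=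
  root (γ p * (1 - γ p) - ‖hat α p‖ ^ 2)

/-- The entropy `S(γ, α)`. -/
def entropy (γ : R3 → ℝ) (α : L2) : ℝ := ∫ p, entropyFn (sFn γ α p)

/-- The BCS functional at temperature `T = 1/β` (with `T = 0` for `β = ∞`) and
chemical potential `μ`. -/
def functional (V : R3 → ℝ) (μ T : ℝ) (x : (R3 → ℝ) × L2) : ℝ :=
  (∫ p, (‖p‖ ^ 2 - μ) * x.1 p) + (∫ r, ‖x.2 r‖ ^ 2 * V r) - T * entropy x.1 x.2

end BCS

end

noncomputable section

namespace BCS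

open Filter Topology

/-! This is the direct method, run in the variables $(\gamma,\hat\alpha)$. The constraint
$|\hat\alpha|^2\le\gamma(1-\gamma)$ says that $(\gamma(p),\hat\alpha(p))$ lies in the ball of radius
$1/2$ about $(1/2,0)$ in $\mathbb{R}\times\mathbb{C}$. The entropy density is a decreasing function
of the distance to the centre, and it is concave on the ball (`concaveOn_pairEntropy`). So kinetic
energy minus $T$ times entropy is the integral of a convex function of the pair.

Coercivity: tilting the entropy by a multiple of $p^2$ bounds the free density below by
$(p^2/2+K)\gamma$ minus an integrable function (`freeDensity_ge`). Since $|\hat\alpha|^2\le\gamma$,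
the moments of $\gamma$ control the $H^1$ norm of $\alpha$. The Sobolev inequality makes $V\in
L^{3/2}$ form bounded with arbitrarily small relative bound (`abs_potential_le`). Hence a minimizing
sequence is bounded in the Hilbert space `PairL2` and has a weakly convergent subsequence.

Lower semicontinuity: the sublevel sets of the free energy are convex, and strongly closed by Fatou,
so Hahn–Banach makes them weakly closed. This also keeps the limit inside the constraint and gives
it finite moments, so it comes from an admissible pair (`exists_admissible_of_mem`).

The potential energy is weakly continuous (`tendsto_potential`). Up to errors uniform on bounded
sets of $H^1$, $V$ may be replaced by a bounded integrable $U$ and $\alpha$ by its low frequency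
part. The value of that part at a point is the pairing of $\hat\alpha$ with a fixed $L^2$ function,
so it converges pointwise, and dominated convergence applies. -/

/-! ### Plancherel and the inverse Fourier integral on $L^1\cap L^2$ -/

theorem lintegral_enorm_sq_eq {E : Type*} [NormedAddCommGroup E] (f : Lp E 2 (volume : Measure R3)) :
    ∫⁻ x, ‖f x‖ₑ ^ 2 = ‖f‖ₑ ^ 2 := by
  rw [Lp.enorm_def, eLpNorm_eq_lintegral_rpow_enorm_toReal (by norm_num) (by norm_num)]
  rw [← ENNReal.rpow_natCast, ← ENNReal.rpow_mul]
  simp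

theorem memLp_two_iff {E : Type*} [NormedAddCommGroup E] {f : R3 → E}
    (hf : AEStronglyMeasurable f) : MemLp f 2 ↔ ∫⁻ x, ‖f x‖ₑ ^ 2 < ∞ := by
  rw [MemLp, eLpNorm_lt_top_iff_lintegral_rpow_enorm_lt_top (by norm_num) (by norm_num)]
  simp [hf]

theorem lintegral_fourier_enorm_sq (α : L2) :
    ∫⁻ ξ, ‖(𝓕 α : L2) ξ‖ₑ ^ 2 = ∫⁻ x, ‖α x‖ₑ ^ 2 := by
  rw [lintegral_enorm_sq_eq, lintegral_enorm_sq_eq, ← ofReal_norm, ← ofReal_norm,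
    Lp.norm_fourier_eq]

theorem continuous_neg_inner : Continuous fun p : R3 × R3 => (-innerₗ R3) p.1 p.2 := by
  change Continuous fun p : R3 × R3 => -inner ℝ p.1 p.2
  fun_prop

theorem integral_fourierInv_smul_eq {f g : R3 → ℂ} (hf : Integrable f) (hg : Integrable g) :
    ∫ x, 𝓕⁻ f x • g x = ∫ x, f x • 𝓕⁻ g x := by
  have h := VectorFourier.integral_fourierIntegral_smul_eq_flip (μ := (volume : Measure R3))
    (ν := (volume : Measure R3)) (L := -innerₗ R3) (e := Real.fourierChar)
    Real.continuous_fourierChar continuous_neg_inner hf hg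
  have h2 : (-innerₗ R3).flip = -innerₗ R3 := by
    ext x y; simp [real_inner_comm]
  rw [h2] at h
  exact h

/-- On `L¹ ∩ L²` the inverse Fourier transform is given by the usual integral. -/
theorem fourierInv_ae_eq (b : L2) (hb : Integrable b) :
    ((𝓕⁻ b : L2) : R3 → ℂ) =ᵐ[volume] 𝓕⁻ (b : R3 → ℂ) := by
  have hc : Continuous (𝓕⁻ (b : R3 → ℂ)) := by
    exact VectorFourier.fourierIntegral_continuous Real.continuous_fourierChar
      continuous_neg_inner hb
  -- Both sides are locally integrable, so testing against $C_c^\infty$ suffices. The $L^2$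
  -- transform agrees with the distributional one, and Fubini moves the integral transform onto the
  -- test function.
  refine ae_eq_of_integral_contDiff_smul_eq ((Lp.memLp _).locallyIntegrable (by norm_num))
    hc.locallyIntegrable ?_
  intro g g_smooth g_cpt
  have hg₁ : HasCompactSupport (Complex.ofRealCLM ∘ g) := g_cpt.comp_left rfl
  have hg₂ : ContDiff ℝ (⊤ : ℕ∞) (Complex.ofRealCLM ∘ g) := by fun_prop
  have h1 := DFunLike.congr_fun (Lp.fourierInv_toTemperedDistribution_eq b)
    (hg₁.toSchwartzMap hg₂)
  rw [TemperedDistribution.fourierInv_apply, Lp.toTemperedDistribution_apply,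
    Lp.toTemperedDistribution_apply] at h1
  have h2 := integral_fourierInv_smul_eq (hg₁.toSchwartzMap hg₂).integrable hb
  rw [← SchwartzMap.fourierInv_coe, h1] at h2
  simpa using h2

/-! ### Splitting off low frequencies -/

/-- The truncation of an `L²` function to a measurable set. -/
def cutoff (b : L2) (s : Set R3) (hs : MeasurableSet s) : L2 := ((Lp.memLp b).indicator hs).toLp

theorem cutoff_ae_eq (b : L2) {s : Set R3} (hs : MeasurableSet s) :
    cutoff b s hs =ᵐ[volume] s.indicator b := MemLp.coeFn_toLp _

theorem integrable_indicator_closedBall (b : L2) (R : ℝ) :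
    Integrable ((Metric.closedBall (0 : R3) R).indicator b) := by
  rw [integrable_indicator_iff measurableSet_closedBall]
  have : IsFiniteMeasure ((volume : Measure R3).restrict (Metric.closedBall (0 : R3) R)) :=
    ⟨by simpa using measure_closedBall_lt_top (μ := (volume : Measure R3)) (x := 0) (r := R)⟩
  exact ((Lp.memLp b).restrict _).integrable (by norm_num)

/-- The part of `α` with frequencies of size at most `R`. -/
def lowPart (α : L2) (R : ℝ) : R3 → ℂ :=
  𝓕⁻ ((Metric.closedBall (0 : R3) R).indicator ((𝓕 α : L2) : R3 → ℂ))

theorem lowPart_ae_eq (α : L2) (R : ℝ) :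
    lowPart α R =ᵐ[volume]
      (𝓕⁻ (cutoff (𝓕 α) (Metric.closedBall 0 R) measurableSet_closedBall) : L2) := by
  have h := cutoff_ae_eq (𝓕 α) (s := Metric.closedBall 0 R) measurableSet_closedBall
  have h2 := fourierInv_ae_eq _ ((integrable_congr h).2 (integrable_indicator_closedBall _ R))
  refine EventuallyEq.trans (Eq.eventuallyEq ?_) h2.symm
  funext x
  rw [lowPart, Real.fourierInv_eq, Real.fourierInv_eq]
  exact integral_congr_ae (h.mono fun y hy => by simp only [hy])

theorem lintegral_sub_lowPart (α : L2) (R : ℝ) :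
    ∫⁻ x, ‖α x - lowPart α R x‖ₑ ^ 2 =
      ∫⁻ ξ in (Metric.closedBall (0 : R3) R)ᶜ, ‖(𝓕 α : L2) ξ‖ₑ ^ 2 := by
  set c := cutoff (𝓕 α) (Metric.closedBall 0 R) measurableSet_closedBall with hc
  have h1 : (fun x => ‖α x - lowPart α R x‖ₑ ^ 2) =ᵐ[volume]
      fun x => ‖(α - 𝓕⁻ c : L2) x‖ₑ ^ 2 := by
    filter_upwards [lowPart_ae_eq α R, Lp.coeFn_sub α (𝓕⁻ c : L2)] with x h1 h2
    rw [h1, h2]; rfl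
  rw [lintegral_congr_ae h1, ← lintegral_fourier_enorm_sq,
    ← lintegral_indicator measurableSet_closedBall.compl]
  refine lintegral_congr_ae ?_
  have h3 : (𝓕 (α - 𝓕⁻ c : L2) : L2) = 𝓕 α - c := by
    have h := (Lp.fourierTransformₗᵢ R3 ℂ).map_sub α (𝓕⁻ c : L2)
    have h' : (𝓕 (α - 𝓕⁻ c : L2) : L2) = 𝓕 α - 𝓕 (𝓕⁻ c : L2) := h
    rw [h', FourierTransform.fourier_fourierInv_eq]
  rw [h3]
  filter_upwards [Lp.coeFn_sub (𝓕 α : L2) c,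
    cutoff_ae_eq (𝓕 α) (s := Metric.closedBall 0 R) measurableSet_closedBall] with x h1 h2
  rw [h1, Pi.sub_apply, h2]
  by_cases hx : x ∈ Metric.closedBall (0 : R3) R
  · rw [Set.indicator_of_mem hx, Set.indicator_of_notMem (by simpa using hx)]; simp
  · rw [Set.indicator_of_notMem hx, Set.indicator_of_mem (by simpa using hx)]; simp

theorem aestronglyMeasurable_lowPart (α : L2) (R : ℝ) :
    AEStronglyMeasurable (lowPart α R) volume :=
  (Lp.aestronglyMeasurable _).congr (lowPart_ae_eq α R).symm

theorem lintegral_lowPart_le (α : L2) (R : ℝ) :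
    ∫⁻ x, ‖lowPart α R x‖ₑ ^ 2 ≤ ∫⁻ x, ‖α x‖ₑ ^ 2 := by
  rw [← lintegral_fourier_enorm_sq α,
    lintegral_congr_ae ((lowPart_ae_eq α R).mono fun x hx => by rw [hx]),
    ← lintegral_fourier_enorm_sq, FourierTransform.fourier_fourierInv_eq]
  refine lintegral_mono_ae ?_
  filter_upwards [cutoff_ae_eq (𝓕 α) (s := Metric.closedBall 0 R) measurableSet_closedBall]
    with x h2
  rw [h2]
  gcongr
  exact enorm_indicator_le_enorm_self _ _

theorem enorm_lowPart_le (α : L2) (R : ℝ) (x : R3) :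
    ‖lowPart α R x‖ₑ ≤ ∫⁻ ξ in Metric.closedBall (0 : R3) R, ‖(𝓕 α : L2) ξ‖ₑ := by
  rw [lowPart, Real.fourierInv_eq']
  refine (enorm_integral_le_lintegral_enorm _).trans (le_of_eq ?_)
  rw [← lintegral_indicator measurableSet_closedBall]
  refine lintegral_congr fun ξ => ?_
  rw [enorm_smul, enorm_indicator_eq_indicator_enorm]
  rw [← ofReal_norm (Complex.exp _), Complex.norm_exp_ofReal_mul_I]
  simp
-- Change of normalization, and membership in $H^1$
theorem lintegral_comp_smul (f : R3 → ℝ≥0∞) {r : ℝ} (hr : r ≠ 0) :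
    ∫⁻ x, f (r • x) = ENNReal.ofReal |(r ^ 3)⁻¹| * ∫⁻ x, f x := by
  have h := Measure.map_addHaar_smul (volume : Measure R3) hr
  rw [finrank_euclideanSpace_fin] at h
  have h2 := lintegral_map_equiv (μ := volume) f (MeasurableEquiv.smul₀ (α := R3) r hr)
  have h3 : Measure.map (MeasurableEquiv.smul₀ (α := R3) r hr) volume =
    Measure.map (fun x => r • x) volume := rfl
  rw [h3, h, lintegral_smul_measure] at h2
  exact h2.symm

theorem quasiMeasurePreserving_smul {r : ℝ} (hr : r ≠ 0) :
    Measure.QuasiMeasurePreserving (fun x : R3 => r • x) volume volume := by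
  refine ⟨measurable_const_smul r, ?_⟩
  rw [Measure.map_addHaar_smul _ hr]
  exact Measure.smul_absolutelyContinuous

theorem two_pi_inv_ne_zero : (2 * Real.pi)⁻¹ ≠ 0 := inv_ne_zero Real.two_pi_pos.ne'

/-- The normalization constant of `hat`. -/
def hatConst : ℂ := (((2 * Real.pi) ^ (-(3 / 2) : ℝ) : ℝ) : ℂ)

theorem hatConst_ne_zero : hatConst ≠ 0 := by
  unfold hatConst
  exact_mod_cast (Real.rpow_pos_of_pos Real.two_pi_pos _).ne'

theorem enorm_hatConst_sq : ‖hatConst‖ₑ ^ 2 = ENNReal.ofReal |(((2 * Real.pi)) ^ 3)⁻¹| := by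
  unfold hatConst
  rw [← ofReal_norm, Complex.norm_real, ← ENNReal.ofReal_pow (norm_nonneg _), Real.norm_eq_abs,
    sq_abs, ← Real.rpow_mul_natCast Real.two_pi_pos.le, abs_of_nonneg (by positivity)]
  norm_num

theorem hat_two_pi_smul (α : L2) (ξ : R3) :
    hat α ((2 * Real.pi) • ξ) = hatConst * (𝓕 α : L2) ξ := by
  rw [hat, smul_smul, inv_mul_cancel₀ Real.two_pi_pos.ne', one_smul, hatConst]

theorem aestronglyMeasurable_hat (α : L2) : AEStronglyMeasurable (hat α) volume :=
  ((Lp.aestronglyMeasurable (𝓕 α : L2)).comp_quasiMeasurePreserving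
    (quasiMeasurePreserving_smul two_pi_inv_ne_zero)).const_mul _

/-- The square of the prefactor $(2\pi)^{-3/2}$ is exactly the Jacobian of $p=2\pi\xi$, so the two
cancel for every weight. -/
theorem lintegral_mul_hat_sq (f : R3 → ℝ≥0∞) (α : L2) :
    ∫⁻ ξ, f ((2 * Real.pi) • ξ) * ‖(𝓕 α : L2) ξ‖ₑ ^ 2 = ∫⁻ p, f p * ‖hat α p‖ₑ ^ 2 := by
  have h := lintegral_comp_smul (fun p => f p * ‖hat α p‖ₑ ^ 2) Real.two_pi_pos.ne'
  have h0 : ‖hatConst‖ₑ ^ 2 ≠ 0 := by simpa using hatConst_ne_zero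
  rw [← enorm_hatConst_sq] at h
  simp only [hat_two_pi_smul, enorm_mul, mul_pow] at h
  have h1 : ∀ ξ, f ((2 * Real.pi) • ξ) * (‖hatConst‖ₑ ^ 2 * ‖(𝓕 α : L2) ξ‖ₑ ^ 2) =
    ‖hatConst‖ₑ ^ 2 * (f ((2 * Real.pi) • ξ) * ‖(𝓕 α : L2) ξ‖ₑ ^ 2) := fun ξ => by ring
  simp only [h1] at h
  rw [lintegral_const_mul' _ _ (by simp)] at h
  exact (ENNReal.mul_right_inj h0 (by simp)).1 h

theorem lintegral_hat_sq (α : L2) : ∫⁻ p, ‖hat α p‖ₑ ^ 2 = ∫⁻ x, ‖α x‖ₑ ^ 2 := by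
  rw [← lintegral_fourier_enorm_sq]
  simpa using (lintegral_mul_hat_sq (fun _ => 1) α).symm

/-- Every square integrable function is the Fourier transform of a square integrable function. -/
theorem exists_hat_ae_eq {a : R3 → ℂ} (ha : MemLp a 2) : ∃ α : L2, hat α =ᵐ[volume] a := by
  have hm : AEStronglyMeasurable (fun ξ : R3 => hatConst⁻¹ * a ((2 * Real.pi) • ξ)) volume :=
    (ha.1.comp_quasiMeasurePreserving
      (quasiMeasurePreserving_smul Real.two_pi_pos.ne')).const_mul _
  have hb : MemLp (fun ξ : R3 => hatConst⁻¹ * a ((2 * Real.pi) • ξ)) 2 := by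
    rw [memLp_two_iff hm]
    simp only [enorm_mul, mul_pow]
    rw [lintegral_const_mul' _ _ (by simp),
      lintegral_comp_smul (fun p => ‖a p‖ₑ ^ 2) Real.two_pi_pos.ne']
    exact ENNReal.mul_lt_top (by simp) (ENNReal.mul_lt_top (by simp) ((memLp_two_iff ha.1).1 ha))
  refine ⟨𝓕⁻ hb.toLp, ?_⟩
  have h1 := (quasiMeasurePreserving_smul two_pi_inv_ne_zero).ae_eq_comp hb.coeFn_toLp
  filter_upwards [h1] with p hp
  simp only [Function.comp] at hp
  rw [hat, FourierTransform.fourier_fourierInv_eq, hp, smul_smul,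
    mul_inv_cancel₀ Real.two_pi_pos.ne', one_smul, ← mul_assoc]
  exact (congrArg (· * a p) (mul_inv_cancel₀ hatConst_ne_zero)).trans (one_mul _)

/-- A square integrable function with `∫ p² |α̂(p)|² dp < ∞` belongs to `H¹`. -/
theorem memSobolev_of_lintegral (α : L2)
    (h : ∫⁻ p, ENNReal.ofReal (‖p‖ ^ 2) * ‖hat α p‖ₑ ^ 2 < ∞) :
    TemperedDistribution.MemSobolev 1 2 (α : 𝓢'(R3, ℂ)) := by
  rw [← lintegral_mul_hat_sq (fun p => ENNReal.ofReal (‖p‖ ^ 2))] at h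
  set w : R3 → ℂ := fun x => (((1 + ‖x‖ ^ 2) ^ ((1 : ℝ) / 2) : ℝ) : ℂ) with hw
  have hwt : w.HasTemperateGrowth := by rw [hw]; fun_prop
  have hm : AEStronglyMeasurable (fun ξ => w ξ * (𝓕 α : L2) ξ) volume :=
    hwt.1.continuous.aestronglyMeasurable.mul (Lp.aestronglyMeasurable _)
  have hwn : ∀ ξ, ‖w ξ‖ₑ ^ 2 = 1 + ENNReal.ofReal (‖ξ‖ ^ 2) := by
    intro ξ
    rw [hw, ← ofReal_norm, ← ENNReal.ofReal_pow (norm_nonneg _), Complex.norm_real,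
      Real.norm_eq_abs, sq_abs, ← Real.rpow_mul_natCast (by positivity)]
    norm_num
    rw [ENNReal.ofReal_add (by norm_num) (by positivity)]
    simp
  have hb : MemLp (fun ξ => w ξ * (𝓕 α : L2) ξ) 2 := by
    rw [memLp_two_iff hm]
    simp only [enorm_mul, mul_pow, hwn, add_mul, one_mul]
    rw [lintegral_add_left' (by fun_prop)]
    refine ENNReal.add_lt_top.2 ⟨?_, lt_of_le_of_lt (lintegral_mono fun ξ => ?_) h⟩
    · rw [lintegral_enorm_sq_eq]; exact ENNReal.pow_lt_top enorm_lt_top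
    · gcongr
      rw [norm_smul]
      refine le_mul_of_one_le_left (norm_nonneg _) ?_
      rw [Real.norm_of_nonneg Real.two_pi_pos.le]
      linarith [Real.pi_gt_three]
  rw [TemperedDistribution.memSobolev_iff_exists_smulLeftCLM_fourier]
  refine ⟨hb.toLp, ?_⟩
  rw [Lp.fourier_toTemperedDistribution_eq]
  ext u
  rw [TemperedDistribution.smulLeftCLM_apply_apply, Lp.toTemperedDistribution_apply,
    Lp.toTemperedDistribution_apply]
  refine integral_congr_ae ?_
  filter_upwards [hb.coeFn_toLp] with x hx
  rw [hx, SchwartzMap.smulLeftCLM_apply_apply hwt]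
  simp only [smul_eq_mul]
  ring

/-! ### The Sobolev inequality, by a level-dependent frequency cutoff -/

theorem lintegral_mul_sq_le {X : Type*} [MeasurableSpace X] (ν : Measure X) {f g : X → ℝ≥0∞}
    (hf : AEMeasurable f ν) (hg : AEMeasurable g ν) :
    (∫⁻ x, f x * g x ∂ν) ^ 2 ≤ (∫⁻ x, f x ^ 2 ∂ν) * ∫⁻ x, g x ^ 2 ∂ν := by
  have h := ENNReal.lintegral_mul_le_Lp_mul_Lq ν
    (Real.holderConjugate_iff.2 ⟨by norm_num, by norm_num⟩ : Real.HolderConjugate 2 2) hf hg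
  simp only [Pi.mul_apply, ENNReal.rpow_ofNat] at h
  calc _ ≤ ((∫⁻ x, f x ^ 2 ∂ν) ^ (1 / 2 : ℝ) * (∫⁻ x, g x ^ 2 ∂ν) ^ (1 / 2 : ℝ)) ^ 2 := by gcongr
    _ = _ := by
      rw [mul_pow, ← ENNReal.rpow_natCast, ← ENNReal.rpow_mul, ← ENNReal.rpow_natCast,
        ← ENNReal.rpow_mul]
      norm_num

/-- The surface area of the unit sphere, in the form in which it enters radial integrals. -/
def sphereConst : ℝ := 3 * (volume : Measure R3).real (Metric.ball 0 1)

theorem sphereConst_pos : 0 < sphereConst := by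
  unfold sphereConst
  have : 0 < (volume : Measure R3).real (Metric.ball 0 1) :=
    ENNReal.toReal_pos (Metric.measure_ball_pos _ _ one_pos).ne' measure_ball_lt_top.ne
  positivity

/-- In polar coordinates in dimension three the factor $r^2$ cancels the singularity, leaving an
integral over $(0,R]$ of a constant. -/
theorem lintegral_closedBall_norm_inv_sq {R : ℝ} (hR : 0 ≤ R) :
    ∫⁻ ξ in Metric.closedBall (0 : R3) R, ENNReal.ofReal ((‖ξ‖ ^ 2)⁻¹) =
      ENNReal.ofReal (sphereConst * R) := by
  set f : ℝ → ℝ := fun y => if y ≤ R then (y ^ 2)⁻¹ else 0 with hf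
  have hcongr : Set.EqOn (fun y : ℝ => y ^ (Module.finrank ℝ R3 - 1) • f y)
      ((Set.Ioc 0 R).indicator fun _ => (1 : ℝ)) (Set.Ioi 0) := by
    intro y hy
    have hy : 0 < y := hy
    simp only [finrank_euclideanSpace_fin, hf, smul_eq_mul]
    by_cases h : y ≤ R
    · rw [Set.indicator_of_mem (show y ∈ Set.Ioc 0 R from ⟨hy, h⟩), if_pos h]
      field_simp
    · rw [Set.indicator_of_notMem (fun h2 => h h2.2), if_neg h, mul_zero]
  have hint : Integrable (fun ξ : R3 => f ‖ξ‖) := by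
    rw [integrable_fun_norm_addHaar]
    refine IntegrableOn.congr_fun ?_ hcongr.symm measurableSet_Ioi
    refine Integrable.integrableOn ?_
    rw [integrable_indicator_iff measurableSet_Ioc]
    simp
  have h1 : ∫⁻ ξ in Metric.closedBall (0 : R3) R, ENNReal.ofReal ((‖ξ‖ ^ 2)⁻¹) =
      ∫⁻ ξ : R3, ENNReal.ofReal (f ‖ξ‖) := by
    rw [← lintegral_indicator measurableSet_closedBall]
    refine lintegral_congr fun ξ => ?_
    by_cases h : ‖ξ‖ ≤ R
    · rw [Set.indicator_of_mem (by simpa using h)]; simp [hf, h]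
    · rw [Set.indicator_of_notMem (by simpa using h)]; simp [hf, h]
  rw [h1, ← ofReal_integral_eq_lintegral_ofReal hint
    (Filter.Eventually.of_forall fun ξ => by
      change 0 ≤ if ‖ξ‖ ≤ R then (‖ξ‖ ^ 2)⁻¹ else 0
      positivity),
    integral_fun_norm_addHaar, setIntegral_congr_fun measurableSet_Ioi hcongr,
    setIntegral_indicator measurableSet_Ioc, Set.inter_eq_right.2 Set.Ioc_subset_Ioi_self]
  simp [sphereConst, hR]
  ring_nf

/-- The kinetic energy `∫ |ξ|² |𝓕α(ξ)|² dξ`. -/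
def kinetic (α : L2) : ℝ≥0∞ := ∫⁻ ξ, ENNReal.ofReal (‖ξ‖ ^ 2) * ‖(𝓕 α : L2) ξ‖ₑ ^ 2

/-- Cauchy–Schwarz for $|\xi|^{-1}\cdot|\xi||\mathcal{F}\alpha|$ on the ball of radius $R$. Only the
kinetic energy enters, and the bound holds at every point because `lowPart` is an honest integral.
-/
theorem enorm_lowPart_sq_le (α : L2) {R : ℝ} (hR : 0 ≤ R) (x : R3) :
    ‖lowPart α R x‖ₑ ^ 2 ≤ ENNReal.ofReal (sphereConst * R) * kinetic α := by
  have hm : AEMeasurable (fun ξ : R3 => ‖(𝓕 α : L2) ξ‖ₑ) volume :=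
    (Lp.aestronglyMeasurable _).enorm
  have hn : AEMeasurable (fun ξ : R3 => ENNReal.ofReal ‖ξ‖ * ‖(𝓕 α : L2) ξ‖ₑ) volume := by
    fun_prop
  have h0 : ∀ᵐ ξ : R3, ‖(𝓕 α : L2) ξ‖ₑ =
      ENNReal.ofReal ‖ξ‖⁻¹ * (ENNReal.ofReal ‖ξ‖ * ‖(𝓕 α : L2) ξ‖ₑ) := by
    have : ∀ᵐ ξ : R3, ξ ≠ 0 := by
      rw [ae_iff]; simp
    filter_upwards [this] with ξ hξ
    rw [← mul_assoc, ← ENNReal.ofReal_mul (by positivity),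
      inv_mul_cancel₀ (norm_ne_zero_iff.2 hξ)]
    simp
  calc ‖lowPart α R x‖ₑ ^ 2
      ≤ (∫⁻ ξ in Metric.closedBall (0 : R3) R, ‖(𝓕 α : L2) ξ‖ₑ) ^ 2 := by
        gcongr; exact enorm_lowPart_le α R x
    _ = (∫⁻ ξ in Metric.closedBall (0 : R3) R,
          ENNReal.ofReal ‖ξ‖⁻¹ * (ENNReal.ofReal ‖ξ‖ * ‖(𝓕 α : L2) ξ‖ₑ)) ^ 2 := by
        rw [lintegral_congr_ae (ae_restrict_of_ae h0)]
    _ ≤ _ := lintegral_mul_sq_le _ (by fun_prop) hn.restrict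
    _ ≤ _ := by
        gcongr
        · rw [← lintegral_closedBall_norm_inv_sq hR]
          refine lintegral_mono fun ξ => ?_
          rw [← ENNReal.ofReal_pow (by positivity), inv_pow]
        · refine (setLIntegral_le_lintegral _ _).trans (lintegral_mono fun ξ => ?_)
          rw [mul_pow, ← ENNReal.ofReal_pow (by positivity)]

/-- The cutoff is the one for which the low part is at most $t/2$ everywhere. Where $|\alpha|>t$ the
high part is then at least $t/2$, and Chebyshev and Plancherel give the bound. -/
theorem measure_norm_gt_le (α : L2) {A t : ℝ} (hA : 0 < A) (hα : kinetic α ≤ ENNReal.ofReal A)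
    (ht : 0 < t) :
    ENNReal.ofReal (t ^ 2 / 4) * volume {x | t < ‖α x‖} ≤
      ∫⁻ ξ in (Metric.closedBall (0 : R3) ((4 * sphereConst * A)⁻¹ * t ^ 2))ᶜ,
        ‖(𝓕 α : L2) ξ‖ₑ ^ 2 := by
  have hC := sphereConst_pos
  set R := (4 * sphereConst * A)⁻¹ * t ^ 2 with hR
  have hR0 : 0 ≤ R := by positivity
  rw [← lintegral_sub_lowPart α R]
  have hm : AEMeasurable (fun x => ‖α x - lowPart α R x‖ₑ ^ 2) volume :=
    ((Lp.aestronglyMeasurable α).sub (aestronglyMeasurable_lowPart α R)).enorm.pow_const 2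
  refine le_trans ?_ (mul_meas_ge_le_lintegral₀ hm (ENNReal.ofReal (t ^ 2 / 4)))
  refine mul_le_mul' le_rfl (measure_mono fun x hx => ?_)
  have hx : t < ‖α x‖ := hx
  have hlow : ‖lowPart α R x‖ₑ ^ 2 ≤ ENNReal.ofReal (t ^ 2 / 4) := by
    refine (enorm_lowPart_sq_le α hR0 x).trans ?_
    calc _ ≤ ENNReal.ofReal (sphereConst * R) * ENNReal.ofReal A := by gcongr
      _ = _ := by
        rw [← ENNReal.ofReal_mul (by positivity)]
        congr 1
        rw [hR]; field_simp
  rw [← ofReal_norm, ← ENNReal.ofReal_pow (norm_nonneg _),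
    ENNReal.ofReal_le_ofReal_iff (by positivity)] at hlow
  have h1 : ‖lowPart α R x‖ ≤ t / 2 := by
    refine abs_le_of_sq_le_sq' ?_ (by positivity) |>.2
    linarith
  have h2 : t / 2 ≤ ‖α x - lowPart α R x‖ := by
    have := norm_sub_norm_le (α x) (lowPart α R x)
    linarith
  change ENNReal.ofReal (t ^ 2 / 4) ≤ ‖α x - lowPart α R x‖ₑ ^ 2
  rw [← ofReal_norm, ← ENNReal.ofReal_pow (norm_nonneg _)]
  refine ENNReal.ofReal_le_ofReal ?_
  nlinarith

/-- The constant in the Sobolev inequality. -/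
def sobolevConst : ℝ := 384 * sphereConst ^ 2

theorem sobolevConst_pos : 0 < sobolevConst := by
  have := sphereConst_pos
  unfold sobolevConst; positivity

/-- The Sobolev inequality `‖α‖₆ ≤ C ‖∇α‖₂` on `ℝ³`. -/
theorem lintegral_enorm_pow_six_le (α : L2) {A : ℝ} (hA : 0 < A)
    (hα : kinetic α ≤ ENNReal.ofReal A) :
    ∫⁻ x, ‖α x‖ₑ ^ 6 ≤ ENNReal.ofReal (sobolevConst * A ^ 3) := by
  have hC := sphereConst_pos
  set κ := (4 * sphereConst * A)⁻¹ with hκ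
  have hκ0 : 0 < κ := by positivity
  set b : R3 → ℂ := ((𝓕 α : L2) : R3 → ℂ) with hb
  have hbm : Measurable b := (Lp.stronglyMeasurable (𝓕 α : L2)).measurable
  -- Layer cake: $\int|\alpha|^6=6\int_0^\infty t^5\,|\{|\alpha|>t\}|\,dt$. The factor $t^2/4$ of
  -- $t^5=4t^3\cdot t^2/4$ goes into the level set estimate.
  have h := lintegral_rpow_eq_lintegral_meas_lt_mul (volume : Measure R3)
    (f := fun x => ‖α x‖) (Filter.Eventually.of_forall fun x => norm_nonneg _)
    (Lp.aestronglyMeasurable α).norm.aemeasurable (p := 6) (by norm_num)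
  have h6 : ∫⁻ x, ‖α x‖ₑ ^ 6 = ∫⁻ x, ENNReal.ofReal (‖α x‖ ^ (6 : ℝ)) := by
    refine lintegral_congr fun x => ?_
    rw [← ofReal_norm, ← ENNReal.ofReal_pow (norm_nonneg _)]
    norm_cast
  set S : Set (ℝ × R3) := {z | κ * z.1 ^ 2 < ‖z.2‖} with hS
  have hSm : MeasurableSet S := measurableSet_lt (by fun_prop) (by fun_prop)
  set F : ℝ → R3 → ℝ≥0∞ := fun t ξ =>
    ENNReal.ofReal (4 * t ^ 3) * (S.indicator (fun _ => 1) (t, ξ) * ‖b ξ‖ₑ ^ 2) with hF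
  have hFm : Measurable (Function.uncurry F) := by
    have : Measurable (S.indicator (fun _ => (1 : ℝ≥0∞))) := measurable_const.indicator hSm
    simp only [hF, Function.uncurry_def]
    fun_prop
  have hstep : ∀ t ∈ Set.Ioi (0 : ℝ), volume {x | t < ‖α x‖} * ENNReal.ofReal (t ^ ((6 : ℝ) - 1)) ≤
      ∫⁻ ξ, F t ξ := by
    intro t ht
    have ht : 0 < t := ht
    have h1 := measure_norm_gt_le α hA hα ht
    rw [← hκ, ← lintegral_indicator measurableSet_closedBall.compl] at h1
    have h2 : t ^ ((6 : ℝ) - 1) = (4 * t ^ 3) * (t ^ 2 / 4) := by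
      rw [show ((6 : ℝ) - 1) = ((5 : ℕ) : ℝ) by norm_num, Real.rpow_natCast]; ring
    rw [h2, ENNReal.ofReal_mul (by positivity), mul_comm, mul_assoc]
    simp only [hF]
    rw [lintegral_const_mul' _ _ ENNReal.ofReal_ne_top]
    gcongr
    refine h1.trans (le_of_eq (lintegral_congr fun ξ => ?_))
    by_cases hx : κ * t ^ 2 < ‖ξ‖
    · rw [Set.indicator_of_mem (by simpa using hx), Set.indicator_of_mem (show (t, ξ) ∈ S from hx),
        one_mul]
    · rw [Set.indicator_of_notMem (by simpa using hx),
        Set.indicator_of_notMem (show (t, ξ) ∉ S from hx), zero_mul]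
  -- For fixed $\xi$ only $t<s=\sqrt{|\xi|/\kappa}$ contributes. Bounding $4t^3$ by $4s^3$ there
  -- gives $4s^4=4|\xi|^2/\kappa^2$, which rebuilds the kinetic energy.
  have hinner : ∀ ξ, ∫⁻ t in Set.Ioi (0 : ℝ), F t ξ ≤
      ENNReal.ofReal (4 / κ ^ 2) * (ENNReal.ofReal (‖ξ‖ ^ 2) * ‖b ξ‖ₑ ^ 2) := by
    intro ξ
    set s := Real.sqrt (‖ξ‖ / κ) with hs
    have hs2 : s ^ 2 = ‖ξ‖ / κ := Real.sq_sqrt (by positivity)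
    have hs0 : 0 ≤ s := Real.sqrt_nonneg _
    have hle : ∀ t ∈ Set.Ioi (0 : ℝ), F t ξ ≤
        (Set.Ioc 0 s).indicator (fun _ => ENNReal.ofReal (4 * s ^ 3) * ‖b ξ‖ₑ ^ 2) t := by
      intro t ht
      have ht : 0 < t := ht
      simp only [hF]
      by_cases hx : κ * t ^ 2 < ‖ξ‖
      · have hts : t ≤ s := by
          refine Real.le_sqrt_of_sq_le ?_
          rw [le_div_iff₀ hκ0]; linarith
        rw [Set.indicator_of_mem (show (t, ξ) ∈ S from hx), one_mul,
          Set.indicator_of_mem (show t ∈ Set.Ioc 0 s from ⟨ht, hts⟩)]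
        gcongr
      · rw [Set.indicator_of_notMem (show (t, ξ) ∉ S from hx), zero_mul, mul_zero]
        exact zero_le
    refine (setLIntegral_mono' measurableSet_Ioi hle).trans ?_
    refine (setLIntegral_le_lintegral _ _).trans (le_of_eq ?_)
    rw [lintegral_indicator measurableSet_Ioc, setLIntegral_const, Real.volume_Ioc, sub_zero,
      ← mul_assoc, mul_right_comm, ← ENNReal.ofReal_mul (by positivity),
      ← ENNReal.ofReal_mul (by positivity)]
    congr 2
    calc 4 * s ^ 3 * s = 4 * (s ^ 2) ^ 2 := by ring
      _ = 4 / κ ^ 2 * ‖ξ‖ ^ 2 := by rw [hs2]; ring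
  rw [h6, h]
  calc _ ≤ ENNReal.ofReal 6 * ∫⁻ t in Set.Ioi (0 : ℝ), ∫⁻ ξ, F t ξ := by
        gcongr 1
        exact setLIntegral_mono' measurableSet_Ioi hstep
    _ = ENNReal.ofReal 6 * ∫⁻ ξ, ∫⁻ t in Set.Ioi (0 : ℝ), F t ξ := by
        rw [lintegral_lintegral_swap hFm.aemeasurable]
    _ ≤ ENNReal.ofReal 6 * (ENNReal.ofReal (4 / κ ^ 2) * kinetic α) := by
        gcongr 1
        rw [kinetic, ← lintegral_const_mul' _ _ (by simp)]
        exact lintegral_mono hinner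
    _ ≤ ENNReal.ofReal 6 * (ENNReal.ofReal (4 / κ ^ 2) * ENNReal.ofReal A) := by gcongr
    _ = _ := by
        rw [← ENNReal.ofReal_mul (by positivity), ← ENNReal.ofReal_mul (by positivity)]
        congr 1
        rw [hκ, sobolevConst]; field_simp; ring

/-! ### The potential energy: form bound and weak continuity -/

theorem three_halves_ne_top : (3 / 2 : ℝ≥0∞) ≠ ∞ := ENNReal.div_ne_top (by simp) (by simp)

/-- The constant in the interpolation of the potential energy by the kinetic energy. -/
def potentialConst : ℝ := sobolevConst ^ (1 / 3 : ℝ)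

theorem potentialConst_pos : 0 < potentialConst := Real.rpow_pos_of_pos sobolevConst_pos _

/-- Hölder with exponents $3$ and $3/2$; the $L^3$ norm of $|\alpha|^2$ is $\|\alpha\|_6^2$, which
Sobolev bounds linearly in the kinetic energy. -/
theorem lintegral_enorm_sq_mul_le (α : L2) {A : ℝ} (hA : 0 < A)
    (hα : kinetic α ≤ ENNReal.ofReal A) {g : R3 → ℝ} (hg : AEStronglyMeasurable g) :
    ∫⁻ x, ‖α x‖ₑ ^ 2 * ‖g x‖ₑ ≤
      ENNReal.ofReal (potentialConst * A) * eLpNorm g (3 / 2 : ℝ≥0∞) volume := by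
  have hC := sobolevConst_pos
  have h := ENNReal.lintegral_mul_le_Lp_mul_Lq (volume : Measure R3) (p := 3) (q := 3 / 2)
    (Real.holderConjugate_iff.2 (by norm_num)) (f := fun x => ‖α x‖ₑ ^ 2) (g := fun x => ‖g x‖ₑ)
    ((Lp.aestronglyMeasurable α).enorm.pow_const 2) hg.enorm
  have h32 : (3 / 2 : ℝ≥0∞).toReal = 3 / 2 := by simp
  have h0 : (3 / 2 : ℝ≥0∞) ≠ 0 := by simp
  have h1 : (3 / 2 : ℝ≥0∞) ≠ ∞ := three_halves_ne_top
  rw [eLpNorm_eq_lintegral_rpow_enorm_toReal h0 h1, h32]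
  refine h.trans ?_
  gcongr
  have h6 : ∀ x, (‖α x‖ₑ ^ 2) ^ (3 : ℝ) = ‖α x‖ₑ ^ 6 := fun x => by
    rw [ENNReal.rpow_ofNat, ← pow_mul]
  simp only [h6]
  calc _ ≤ ENNReal.ofReal (sobolevConst * A ^ 3) ^ (1 / 3 : ℝ) := by
        gcongr
        exact lintegral_enorm_pow_six_le α hA hα
    _ = _ := by
      rw [ENNReal.ofReal_rpow_of_nonneg (by positivity) (by norm_num), potentialConst,
        Real.mul_rpow hC.le (by positivity), ← Real.rpow_natCast_mul hA.le]
      norm_num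

/-- A potential in `L^{3/2}` is the sum of a bounded integrable one and one that is relatively
small with respect to the kinetic energy. -/
theorem exists_potential_approx {V : R3 → ℝ} (hV : MemLp V (3 / 2 : ℝ≥0∞) volume) {ε : ℝ}
    (hε : 0 < ε) : ∃ (U : R3 → ℝ) (M : ℝ), 0 < M ∧ (∀ x, ‖U x‖ ≤ M) ∧ Integrable U ∧
      ∀ (α : L2) (A : ℝ), 0 < A → kinetic α ≤ ENNReal.ofReal A →
        ∫⁻ x, ‖α x‖ₑ ^ 2 * ‖V x - U x‖ₑ ≤ ENNReal.ofReal (ε * A) := by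
  have h1 : (3 / 2 : ℝ≥0∞) ≠ ∞ := three_halves_ne_top
  have hC := potentialConst_pos
  -- Continuous compactly supported functions are dense in $L^{3/2}$; the tolerance is divided by
  -- the constant of the Hölder–Sobolev bound.
  obtain ⟨U, hUc, hU, hUcont, -⟩ := hV.exists_hasCompactSupport_eLpNorm_sub_le h1
    (ε := ENNReal.ofReal (ε / potentialConst)) (by simp; positivity)
  obtain ⟨M, hM⟩ := hUc.exists_bound_of_continuous hUcont
  refine ⟨U, |M| + 1, by positivity, fun x => (hM x).trans (by linarith [le_abs_self M]),
    hUcont.integrable_of_hasCompactSupport hUc, fun α A hA hα => ?_⟩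
  refine (lintegral_enorm_sq_mul_le α hA hα
    (hV.1.sub hUcont.aestronglyMeasurable)).trans ?_
  refine (mul_le_mul' le_rfl hU).trans (le_of_eq ?_)
  rw [← ENNReal.ofReal_mul (by positivity)]
  congr 1
  field_simp

theorem lintegral_enorm_sq_lt_top (α : L2) : ∫⁻ x, ‖α x‖ₑ ^ 2 < ∞ :=
  (memLp_two_iff (Lp.aestronglyMeasurable α)).1 (Lp.memLp α)

theorem lintegral_enorm_potential_le {V U : R3 → ℝ} {M : ℝ} (hU : ∀ x, ‖U x‖ ≤ M)
    (hVm : AEStronglyMeasurable V) (hUm : AEStronglyMeasurable U) (α : L2) :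
    ∫⁻ x, ‖‖α x‖ ^ 2 * V x‖ₑ ≤
      (∫⁻ x, ‖α x‖ₑ ^ 2 * ‖V x - U x‖ₑ) + ENNReal.ofReal M * ∫⁻ x, ‖α x‖ₑ ^ 2 := by
  have hm : AEMeasurable (fun x => ‖α x‖ₑ ^ 2) volume :=
    (Lp.aestronglyMeasurable α).enorm.pow_const 2
  have hm2 : AEMeasurable (fun x => ‖α x‖ₑ ^ 2 * ‖V x - U x‖ₑ) volume :=
    hm.mul (hVm.sub hUm).enorm
  rw [← lintegral_const_mul' _ _ (by simp), ← lintegral_add_left' hm2]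
  refine lintegral_mono fun x => ?_
  rw [enorm_mul, enorm_pow, enorm_norm, mul_comm (ENNReal.ofReal M), ← mul_add]
  gcongr
  calc ‖V x‖ₑ = ‖(V x - U x) + U x‖ₑ := by rw [sub_add_cancel]
    _ ≤ ‖V x - U x‖ₑ + ‖U x‖ₑ := enorm_add_le _ _
    _ ≤ _ := by
      gcongr
      rw [← ofReal_norm]
      exact ENNReal.ofReal_le_ofReal (hU x)

theorem integrable_potential {V : R3 → ℝ} (hV : MemLp V (3 / 2 : ℝ≥0∞) volume) (α : L2)
    (hα : kinetic α < ∞) : Integrable fun x => ‖α x‖ ^ 2 * V x := by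
  obtain ⟨U, M, hM, hU, hUi, h⟩ := exists_potential_approx hV one_pos
  have hA : kinetic α ≤ ENNReal.ofReal ((kinetic α).toReal + 1) :=
    ENNReal.le_ofReal_iff_toReal_le hα.ne (by positivity) |>.2 (by linarith)
  refine ⟨((Lp.aestronglyMeasurable α).norm.pow 2).mul hV.1, ?_⟩
  refine (lintegral_enorm_potential_le hU hV.1 hUi.1 α).trans_lt ?_
  refine ENNReal.add_lt_top.2 ⟨(h α _ (by positivity) hA).trans_lt (by simp), ?_⟩
  exact ENNReal.mul_lt_top (by simp) (lintegral_enorm_sq_lt_top α)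

/-- The potential energy is form bounded with arbitrarily small relative bound. -/
theorem abs_potential_le {V : R3 → ℝ} (hV : MemLp V (3 / 2 : ℝ≥0∞) volume) {ε : ℝ}
    (hε : 0 < ε) : ∃ M : ℝ, 0 < M ∧ ∀ (α : L2) (A B : ℝ), 0 < A → 0 ≤ B →
      kinetic α ≤ ENNReal.ofReal A → ∫⁻ x, ‖α x‖ₑ ^ 2 ≤ ENNReal.ofReal B →
      |∫ x, ‖α x‖ ^ 2 * V x| ≤ ε * A + M * B := by
  obtain ⟨U, M, hM, hU, hUi, h⟩ := exists_potential_approx hV hε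
  refine ⟨M, hM, fun α A B hA hB hα hm => ?_⟩
  have h1 := (enorm_integral_le_lintegral_enorm (fun x => ‖α x‖ ^ 2 * V x)).trans
    (lintegral_enorm_potential_le hU hV.1 hUi.1 α)
  have h2 : ‖∫ x, ‖α x‖ ^ 2 * V x‖ₑ ≤ ENNReal.ofReal (ε * A + M * B) := by
    rw [ENNReal.ofReal_add (by positivity) (by positivity), ENNReal.ofReal_mul hM.le]
    refine h1.trans ?_
    gcongr
    exact h α A hA hα
  rwa [← ofReal_norm, ENNReal.ofReal_le_ofReal_iff (by positivity), Real.norm_eq_abs] at h2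

/-- The removed frequencies satisfy $1\le|\xi|^2/R^2$. -/
theorem lintegral_sub_lowPart_le (α : L2) {R A : ℝ} (hR : 0 < R)
    (hα : kinetic α ≤ ENNReal.ofReal A) :
    ∫⁻ x, ‖α x - lowPart α R x‖ₑ ^ 2 ≤ ENNReal.ofReal (A / R ^ 2) := by
  rw [lintegral_sub_lowPart, div_eq_inv_mul, ENNReal.ofReal_mul (by positivity)]
  refine le_trans ?_ (mul_le_mul' le_rfl hα)
  rw [kinetic, ← lintegral_const_mul' _ _ (by simp), ← lintegral_indicator
    measurableSet_closedBall.compl]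
  refine lintegral_mono fun ξ => ?_
  by_cases hx : ξ ∈ Metric.closedBall (0 : R3) R
  · rw [Set.indicator_of_notMem (by simpa using hx)]; exact zero_le
  · rw [Set.indicator_of_mem (by simpa using hx), ← mul_assoc,
      ← ENNReal.ofReal_mul (by positivity)]
    have hx : R < ‖ξ‖ := by simpa using hx
    refine le_mul_of_one_le_left zero_le ?_
    rw [ENNReal.one_le_ofReal, inv_mul_eq_div, one_le_div (by positivity)]
    gcongr

theorem lintegral_mul_le_of_sq_le {f g : R3 → ℝ≥0∞} (hf : AEMeasurable f) (hg : AEMeasurable g)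
    {a b c : ℝ} (hb : 0 ≤ b) (hc : 0 ≤ c) (hf2 : ∫⁻ x, f x ^ 2 ≤ ENNReal.ofReal a)
    (hg2 : ∫⁻ x, g x ^ 2 ≤ ENNReal.ofReal b) (habc : a * b = c ^ 2) :
    ∫⁻ x, f x * g x ≤ ENNReal.ofReal c := by
  have h := (lintegral_mul_sq_le volume hf hg).trans (mul_le_mul' hf2 hg2)
  rw [mul_comm, ← ENNReal.ofReal_mul hb, mul_comm, habc, ENNReal.ofReal_pow hc] at h
  exact (ENNReal.pow_le_pow_left_iff two_ne_zero).1 h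

/-- Pointwise $\bigl||a|^2-|b|^2\bigr|\le|a-b|(|a|+|b|)$. Cauchy–Schwarz then gives $A/R$ for each
of the two products. -/
theorem lintegral_sq_sub_sq_lowPart_le (α : L2) {R A : ℝ} (hR : 0 < R) (hA : 0 < A)
    (hα : kinetic α ≤ ENNReal.ofReal A) (hm : ∫⁻ x, ‖α x‖ₑ ^ 2 ≤ ENNReal.ofReal A) :
    ∫⁻ x, ‖‖α x‖ ^ 2 - ‖lowPart α R x‖ ^ 2‖ₑ ≤ ENNReal.ofReal (2 * A / R) := by
  have ha : AEMeasurable (fun x => ‖α x‖ₑ) volume := (Lp.aestronglyMeasurable α).enorm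
  have hl : AEMeasurable (fun x => ‖lowPart α R x‖ₑ) volume :=
    (aestronglyMeasurable_lowPart α R).enorm
  have hd : AEMeasurable (fun x => ‖α x - lowPart α R x‖ₑ) volume :=
    ((Lp.aestronglyMeasurable α).sub (aestronglyMeasurable_lowPart α R)).enorm
  have hd2 := lintegral_sub_lowPart_le α hR hα
  have hc : A / R ^ 2 * A = (A / R) ^ 2 := by field_simp
  have h1 := lintegral_mul_le_of_sq_le hd ha hA.le (by positivity) hd2 hm hc
  have h2 := lintegral_mul_le_of_sq_le hd hl hA.le (by positivity) hd2
    ((lintegral_lowPart_le α R).trans hm) hc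
  have h3 : 2 * A / R = A / R + A / R := by ring
  rw [h3, ENNReal.ofReal_add (by positivity) (by positivity)]
  refine le_trans ?_ (add_le_add h1 h2)
  have hda : AEMeasurable (fun x => ‖α x - lowPart α R x‖ₑ * ‖α x‖ₑ) volume := hd.mul ha
  rw [← lintegral_add_left' hda]
  refine lintegral_mono fun x => ?_
  simp only [← ofReal_norm]
  rw [← ENNReal.ofReal_mul (norm_nonneg _), ← ENNReal.ofReal_mul (norm_nonneg _),
    ← ENNReal.ofReal_add (by positivity) (by positivity), ← mul_add]
  refine ENNReal.ofReal_le_ofReal ?_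
  rw [sq_sub_sq, norm_mul, mul_comm, Real.norm_eq_abs, Real.norm_eq_abs,
    abs_of_nonneg (add_nonneg (norm_nonneg _) (norm_nonneg _))]
  gcongr
  exact abs_norm_sub_norm_le _ _

theorem norm_lowPart_sq_le (α : L2) {R A : ℝ} (hR : 0 < R) (hA : 0 < A)
    (hα : kinetic α ≤ ENNReal.ofReal A) (x : R3) :
    ‖lowPart α R x‖ ^ 2 ≤ sphereConst * R * A := by
  have hC := sphereConst_pos
  have h := (enorm_lowPart_sq_le α hR.le x).trans (mul_le_mul' le_rfl hα)
  rwa [← ofReal_norm, ← ENNReal.ofReal_pow (norm_nonneg _), ← ENNReal.ofReal_mul (by positivity),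
    ENNReal.ofReal_le_ofReal_iff (by positivity)] at h

theorem integrable_lowPart_sq_mul {U : R3 → ℝ} (hU : Integrable U) (α : L2) {R A : ℝ} (hR : 0 < R)
    (hA : 0 < A) (hα : kinetic α ≤ ENNReal.ofReal A) :
    Integrable fun x => ‖lowPart α R x‖ ^ 2 * U x :=
  hU.bdd_mul ((aestronglyMeasurable_lowPart α R).norm.pow 2)
    (Eventually.of_forall fun x => by
      rw [Real.norm_of_nonneg (by positivity)]
      exact norm_lowPart_sq_le α hR hA hα x)

/-- The first error comes from replacing $V$ by $U$, the second from replacing $\alpha$ by its low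
part against the bounded $U$. Both depend on $\alpha$ only through $A$, so they are uniform along a
bounded sequence. -/
theorem abs_potential_sub_lowPart_le {V U : R3 → ℝ} {M ε : ℝ} (hM : 0 < M) (hε : 0 < ε)
    (hU : ∀ x, ‖U x‖ ≤ M) (hV : MemLp V (3 / 2 : ℝ≥0∞) volume) (hUi : Integrable U)
    (α : L2) {R A : ℝ} (hR : 0 < R) (hA : 0 < A)
    (hα : kinetic α ≤ ENNReal.ofReal A) (hm : ∫⁻ x, ‖α x‖ₑ ^ 2 ≤ ENNReal.ofReal A)
    (hVU : ∫⁻ x, ‖α x‖ₑ ^ 2 * ‖V x - U x‖ₑ ≤ ENNReal.ofReal (ε * A)) :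
    |(∫ x, ‖α x‖ ^ 2 * V x) - ∫ x, ‖lowPart α R x‖ ^ 2 * U x| ≤ ε * A + M * (2 * A / R) := by
  have hi := integrable_potential hV α (hα.trans_lt (by simp))
  rw [← integral_sub hi (integrable_lowPart_sq_mul hUi α hR hA hα)]
  have hmeas : AEMeasurable (fun x => ‖α x‖ₑ ^ 2 * ‖V x - U x‖ₑ) volume :=
    ((Lp.aestronglyMeasurable α).enorm.pow_const 2).mul (hV.1.sub hUi.1).enorm
  have h2 : ‖∫ x, (‖α x‖ ^ 2 * V x - ‖lowPart α R x‖ ^ 2 * U x)‖ₑ ≤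
      ENNReal.ofReal (ε * A + M * (2 * A / R)) := by
    rw [ENNReal.ofReal_add (by positivity) (by positivity), ENNReal.ofReal_mul hM.le]
    refine (enorm_integral_le_lintegral_enorm _).trans (le_trans ?_ (add_le_add hVU
      (mul_le_mul' le_rfl (lintegral_sq_sub_sq_lowPart_le α hR hA hα hm))))
    rw [← lintegral_const_mul' _ _ (by simp), ← lintegral_add_left' hmeas]
    refine lintegral_mono fun x => ?_
    calc ‖‖α x‖ ^ 2 * V x - ‖lowPart α R x‖ ^ 2 * U x‖ₑ
        = ‖‖α x‖ ^ 2 * (V x - U x) + U x * (‖α x‖ ^ 2 - ‖lowPart α R x‖ ^ 2)‖ₑ := by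
          congr 1; ring
      _ ≤ _ := enorm_add_le _ _
      _ ≤ _ := by
        rw [enorm_mul, enorm_mul, enorm_pow, enorm_norm]
        gcongr
        rw [← ofReal_norm]
        exact ENNReal.ofReal_le_ofReal (hU x)
  rwa [← ofReal_norm, ENNReal.ofReal_le_ofReal_iff (by positivity), Real.norm_eq_abs] at h2

/-- The potential energy is weakly continuous on bounded subsets of `H¹`. -/
theorem tendsto_potential {V : R3 → ℝ} (hV : MemLp V (3 / 2 : ℝ≥0∞) volume) {αs : ℕ → L2} {α : L2}
    {A : ℝ} (hA : 0 < A) (hk : ∀ n, kinetic (αs n) ≤ ENNReal.ofReal A)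
    (hm : ∀ n, ∫⁻ x, ‖αs n x‖ₑ ^ 2 ≤ ENNReal.ofReal A) (hk' : kinetic α ≤ ENNReal.ofReal A)
    (hm' : ∫⁻ x, ‖α x‖ₑ ^ 2 ≤ ENNReal.ofReal A)
    (hlow : ∀ R x, Tendsto (fun n => lowPart (αs n) R x) atTop (𝓝 (lowPart α R x))) :
    Tendsto (fun n => ∫ x, ‖αs n x‖ ^ 2 * V x) atTop (𝓝 (∫ x, ‖α x‖ ^ 2 * V x)) := by
  rw [Metric.tendsto_atTop]
  intro δ hδ
  obtain ⟨U, M, hM, hU, hUi, hVU⟩ := exists_potential_approx hV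
    (ε := δ / (6 * A)) (by positivity)
  -- With this $R$ and the tolerance $\delta/(6A)$ each of the two errors is $\delta/6$.
  set R := 12 * M * A / δ with hR
  have hR0 : 0 < R := by positivity
  have hbound : δ / (6 * A) * A + M * (2 * A / R) = δ / 3 := by
    rw [hR]; field_simp; norm_num
  have hlim : Tendsto (fun n => ∫ x, ‖lowPart (αs n) R x‖ ^ 2 * U x) atTop
      (𝓝 (∫ x, ‖lowPart α R x‖ ^ 2 * U x)) := by
    refine tendsto_integral_of_dominated_convergence
      (fun x => sphereConst * R * A * ‖U x‖) (fun n =>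
        (integrable_lowPart_sq_mul hUi (αs n) hR0 hA (hk n)).1) (hUi.norm.const_mul _) ?_ ?_
    · refine fun n => Eventually.of_forall fun x => ?_
      rw [norm_mul, Real.norm_of_nonneg (sq_nonneg _)]
      gcongr
      exact norm_lowPart_sq_le (αs n) hR0 hA (hk n) x
    · exact Eventually.of_forall fun x => ((hlow R x).norm.pow 2).mul_const _
  obtain ⟨N, hN⟩ := Metric.tendsto_atTop.1 hlim (δ / 3) (by positivity)
  refine ⟨N, fun n hn => ?_⟩
  have h1 := abs_potential_sub_lowPart_le hM (by positivity) hU hV hUi (αs n) hR0 hA (hk n) (hm n)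
    (hVU (αs n) A hA (hk n))
  have h2 := abs_potential_sub_lowPart_le hM (by positivity) hU hV hUi α hR0 hA hk' hm'
    (hVU α A hA hk')
  have h3 := hN n hn
  rw [hbound] at h1 h2
  rw [Real.dist_eq] at h3 ⊢
  rw [abs_le] at h1 h2
  rw [abs_lt] at h3 ⊢
  constructor <;> linarith [h1.1, h1.2, h2.1, h2.2, h3.1, h3.2]

/-! ### The pointwise problem: convexity and lower bound of the free density -/

/-- The space of values of the pairs `(γ, α̂)`. -/
abbrev PairSpace : Type := WithLp 2 (ℝ × ℂ)

/-- The centre `(1/2, 0)` of the ball of admissible values. -/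
def pairCenter : PairSpace := WithLp.toLp 2 (1 / 2, 0)

/-- The admissible values `|a|² ≤ g (1 - g)` form a ball. -/
def pairBall : Set PairSpace := Metric.closedBall pairCenter (1 / 2)

/-- The entropy density of a pair `(g, a)`. -/
def pairEntropy (u : PairSpace) : ℝ := Real.binEntropy (1 / 2 + ‖u - pairCenter‖)

theorem norm_sub_pairCenter_sq (u : PairSpace) :
    ‖u - pairCenter‖ ^ 2 = (u.fst - 1 / 2) ^ 2 + ‖u.snd‖ ^ 2 := by
  rw [WithLp.prod_norm_sq_eq_of_L2]
  simp [pairCenter]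

theorem norm_pair_sq (u : PairSpace) : ‖u‖ ^ 2 = u.fst ^ 2 + ‖u.snd‖ ^ 2 := by
  rw [WithLp.prod_norm_sq_eq_of_L2]
  simp

theorem mem_pairBall {u : PairSpace} : u ∈ pairBall ↔ ‖u.snd‖ ^ 2 ≤ u.fst * (1 - u.fst) := by
  rw [pairBall, mem_closedBall_iff_norm, ← abs_of_nonneg (norm_nonneg (u - pairCenter)),
    ← sq_le_sq₀ (by positivity) (by norm_num), sq_abs, norm_sub_pairCenter_sq]
  constructor <;> intro h <;> nlinarith

theorem fst_mem_of_mem_pairBall {u : PairSpace} (hu : u ∈ pairBall) : 0 ≤ u.fst ∧ u.fst ≤ 1 := by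
  have h := (sq_nonneg _).trans (mem_pairBall.1 hu)
  constructor <;> nlinarith

theorem convex_pairBall : Convex ℝ pairBall := convex_closedBall _ _

theorem continuous_pairEntropy : Continuous pairEntropy := by
  unfold pairEntropy
  exact Real.binEntropy_continuous.comp (by fun_prop)

theorem entropyFn_eq_binEntropy (s : ℝ) : entropyFn s = Real.binEntropy s := by
  rw [entropyFn, Real.binEntropy, Real.log_inv, Real.log_inv]; ring

/-- Since $\gamma(1-\gamma)-|\hat\alpha|^2=1/4-\|u-\text{centre}\|^2$, the number
$1/2+\|u-\text{centre}\|$ is the larger root of the equation for $s$, and either root gives the same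
entropy. -/
theorem entropyFn_sFn (γ : R3 → ℝ) (α : L2) (p : R3) :
    entropyFn (sFn γ α p) = pairEntropy (WithLp.toLp 2 (γ p, hat α p)) := by
  rw [sFn, pairEntropy, ← entropyFn_eq_binEntropy]
  refine (entropyFn_root ?_).symm
  have h : _ = (γ p - 1 / 2) ^ 2 + ‖hat α p‖ ^ 2 :=
    norm_sub_pairCenter_sq (WithLp.toLp 2 (γ p, hat α p))
  linear_combination -h

theorem half_add_mem {u : PairSpace} (hu : u ∈ pairBall) :
    1 / 2 + ‖u - pairCenter‖ ∈ Set.Icc (2⁻¹ : ℝ) 1 := by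
  rw [pairBall, mem_closedBall_iff_norm] at hu
  constructor <;> linarith [norm_nonneg (u - pairCenter)]

theorem pairEntropy_nonneg {u : PairSpace} (hu : u ∈ pairBall) : 0 ≤ pairEntropy u := by
  have h := half_add_mem hu
  exact Real.binEntropy_nonneg (by linarith [h.1]) h.2

/-- The binary entropy is concave and decreasing on $[1/2,1]$, and the distance to the centre is
convex; a decreasing concave function of a convex one is concave. -/
theorem concaveOn_pairEntropy : ConcaveOn ℝ pairBall pairEntropy := by
  refine ⟨convex_pairBall, fun u hu v hv s t hs ht hst => ?_⟩
  have hu' := half_add_mem hu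
  have hv' := half_add_mem hv
  have hw' := half_add_mem (convex_pairBall hu hv hs ht hst)
  have h1 := Real.strictConcave_binEntropy.concaveOn.2
    (show (1 / 2 + ‖u - pairCenter‖) ∈ Set.Icc (0 : ℝ) 1 from ⟨by linarith [hu'.1], hu'.2⟩)
    (show (1 / 2 + ‖v - pairCenter‖) ∈ Set.Icc (0 : ℝ) 1 from ⟨by linarith [hv'.1], hv'.2⟩)
    hs ht hst
  refine h1.trans ?_
  have hn : ‖s • u + t • v - pairCenter‖ ≤ s * ‖u - pairCenter‖ + t * ‖v - pairCenter‖ := by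
    have : s • u + t • v - pairCenter = s • (u - pairCenter) + t • (v - pairCenter) := by
      rw [smul_sub, smul_sub, sub_add_sub_comm, ← add_smul, hst, one_smul]
    rw [this]
    refine (norm_add_le _ _).trans (le_of_eq ?_)
    rw [norm_smul, norm_smul, Real.norm_of_nonneg hs, Real.norm_of_nonneg ht]
  have he : s • (1 / 2 + ‖u - pairCenter‖) + t • (1 / 2 + ‖v - pairCenter‖) =
      1 / 2 + (s * ‖u - pairCenter‖ + t * ‖v - pairCenter‖) := by
    simp only [smul_eq_mul]; linear_combination (1 / 2) * hst
  rw [he]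
  refine Real.binEntropy_strictAntiOn.antitoneOn hw' ?_ (by linarith)
  rw [← he]
  exact convex_Icc _ _ hu' hv' hs ht hst

/-- Gibbs variational bound: $\ln y\le y-1$ at $y=e^{-\tau}/g$ controls the first term for any tilt
$\tau$, and the second term is at most $g$. -/
theorem binEntropy_le {g : ℝ} (h0 : 0 ≤ g) (h1 : g ≤ 1) (τ : ℝ) :
    Real.binEntropy g ≤ (τ + 1) * g + Real.exp (-τ) := by
  rw [← entropyFn_eq_binEntropy, entropyFn]
  have ha : -(g * Real.log g) ≤ τ * g + Real.exp (-τ) := by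
    rcases h0.eq_or_lt with rfl | h
    · simp; positivity
    · have h2 := Real.log_le_sub_one_of_pos (show 0 < Real.exp (-τ) / g by positivity)
      rw [Real.log_div (by positivity) h.ne', Real.log_exp] at h2
      have h3 := mul_le_mul_of_nonneg_left h2 h.le
      have h4 : g * (Real.exp (-τ) / g - 1) = Real.exp (-τ) - g := by field_simp
      rw [h4] at h3
      nlinarith
  have hb : -((1 - g) * Real.log (1 - g)) ≤ g := by
    rcases h1.eq_or_lt with rfl | h
    · simp
    · have hp : 0 < 1 - g := by linarith
      have h2 := Real.one_sub_inv_le_log_of_pos hp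
      have h3 := mul_le_mul_of_nonneg_left h2 hp.le
      have h4 : (1 - g) * (1 - (1 - g)⁻¹) = -g := by field_simp; ring
      linarith
  linarith

/-- A nonzero $\hat\alpha$ only moves the pair away from the centre, so the entropy is at most that
of $\gamma$ alone. -/
theorem pairEntropy_le {u : PairSpace} (hu : u ∈ pairBall) (τ : ℝ) :
    pairEntropy u ≤ (τ + 1) * u.fst + Real.exp (-τ) := by
  obtain ⟨h0, h1⟩ := fst_mem_of_mem_pairBall hu
  refine le_trans ?_ (binEntropy_le h0 h1 τ)
  have habs : |u.fst - 1 / 2| ≤ ‖u - pairCenter‖ := by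
    refine abs_le_of_sq_le_sq ?_ (norm_nonneg _)
    rw [norm_sub_pairCenter_sq]
    linarith [sq_nonneg ‖u.snd‖]
  have hsym : Real.binEntropy u.fst = Real.binEntropy (1 / 2 + |u.fst - 1 / 2|) := by
    rcases abs_cases (u.fst - 1 / 2) with ⟨h, -⟩ | ⟨h, -⟩ <;> rw [h]
    · congr 1; ring
    · rw [← Real.binEntropy_one_sub]; congr 1; ring
  rw [hsym]
  refine Real.binEntropy_strictAntiOn.antitoneOn ⟨by linarith [abs_nonneg (u.fst - 1 / 2)], ?_⟩
    (half_add_mem hu) (by linarith)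
  linarith [(half_add_mem hu).2]

/-- The integrand of the functional without the potential energy. -/
def freeDensity (μ T : ℝ) (p : R3) (u : PairSpace) : ℝ :=
  (‖p‖ ^ 2 - μ) * u.fst - T * pairEntropy u

/-- An integrable function that controls the negative part of `freeDensity`. -/
def lowerBound (L T : ℝ) (p : R3) : ℝ :=
  (Metric.closedBall (0 : R3) (2 * Real.sqrt L)).indicator (fun _ => L) p +
    T * Real.exp (-((4 * (T + 1))⁻¹ * ‖p‖ ^ 2))

theorem integrable_exp_neg_mul_norm_sq {b : ℝ} (hb : 0 < b) :
    Integrable fun p : R3 => Real.exp (-(b * ‖p‖ ^ 2)) := by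
  have h := (GaussianFourier.integrable_cexp_neg_mul_sq_norm_add (V := R3) (b := (b : ℂ))
    (by simpa using hb) 0 0).norm
  refine h.congr (Eventually.of_forall fun p => ?_)
  simp only [Complex.norm_exp]
  congr 1
  norm_cast
  simp

theorem integrable_lowerBound (L : ℝ) {T : ℝ} (hT : 0 ≤ T) : Integrable (lowerBound L T) := by
  refine Integrable.add ?_ ((integrable_exp_neg_mul_norm_sq (by positivity)).const_mul T)
  rw [integrable_indicator_iff measurableSet_closedBall]
  exact integrableOn_const measure_closedBall_lt_top.ne

/-- The tilt $\tau=p^2/(4(T+1))$ costs at most a quarter of the kinetic energy and leaves a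
Gaussian; the denominator is nonzero at $T=0$ too. Another quarter absorbs $|\mu|+T+K$ outside the
ball of radius $2\sqrt L$. Inside it, $\gamma\le1$ bounds that term by the constant $L$. -/
theorem freeDensity_ge {μ T K : ℝ} (hT : 0 ≤ T) (hK : 0 ≤ K) (p : R3) {u : PairSpace}
    (hu : u ∈ pairBall) :
    (‖p‖ ^ 2 / 2 + K) * u.fst ≤ freeDensity μ T p u + lowerBound (|μ| + T + K) T p := by
  obtain ⟨h0, h1⟩ := fst_mem_of_mem_pairBall hu
  set L := |μ| + T + K with hL
  have hL0 : 0 ≤ L := by positivity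
  set τ := (4 * (T + 1))⁻¹ * ‖p‖ ^ 2 with hτ
  have hS := mul_le_mul_of_nonneg_left (pairEntropy_le hu τ) hT
  have hTτ : T * τ ≤ ‖p‖ ^ 2 / 4 := by
    rw [hτ, ← mul_assoc, div_eq_inv_mul]
    gcongr
    rw [← div_eq_mul_inv, div_le_iff₀ (by positivity)]
    linarith
  have hTg := mul_le_mul_of_nonneg_right hTτ h0
  have hμ := mul_le_mul_of_nonneg_right (le_abs_self μ) h0
  have hind : L * u.fst ≤ ‖p‖ ^ 2 / 4 * u.fst +
      (Metric.closedBall (0 : R3) (2 * Real.sqrt L)).indicator (fun _ => L) p := by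
    by_cases hp : p ∈ Metric.closedBall (0 : R3) (2 * Real.sqrt L)
    · rw [Set.indicator_of_mem hp]
      have : 0 ≤ ‖p‖ ^ 2 / 4 * u.fst := by positivity
      nlinarith
    · rw [Set.indicator_of_notMem hp, add_zero]
      have hp : 2 * Real.sqrt L < ‖p‖ := by simpa using hp
      have h2 : L ≤ ‖p‖ ^ 2 / 4 := by
        have h3 := Real.sq_sqrt hL0
        have h4 := Real.sqrt_nonneg L
        nlinarith
      gcongr
  simp only [freeDensity, lowerBound, ← hτ]
  rw [hL] at hind ⊢
  nlinarith

theorem freeDensity_convex {μ T : ℝ} (hT : 0 ≤ T) (p : R3) : ConvexOn ℝ pairBall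
    (freeDensity μ T p) := by
  refine ⟨convex_pairBall, fun u hu v hv s t hs ht hst => ?_⟩
  have h := mul_le_mul_of_nonneg_left (concaveOn_pairEntropy.2 hu hv hs ht hst) hT
  simp only [smul_eq_mul, freeDensity, WithLp.add_fst, WithLp.smul_fst] at h ⊢
  linarith

theorem continuous_freeDensity (μ T : ℝ) :
    Continuous fun z : R3 × PairSpace => freeDensity μ T z.1 z.2 := by
  have h := continuous_pairEntropy
  have h2 : Continuous fun u : PairSpace => u.fst := by fun_prop
  unfold freeDensity
  fun_prop

theorem continuous_freeDensity_right (μ T : ℝ) (p : R3) : Continuous (freeDensity μ T p) := by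
  have h := continuous_pairEntropy
  have h2 : Continuous fun u : PairSpace => u.fst := by fun_prop
  unfold freeDensity
  fun_prop

/-! ### Weak compactness and weakly closed sublevel sets -/

/-- Bounded sequences in a separable Hilbert space have weakly convergent subsequences. -/
theorem exists_weakly_convergent_subseq {H : Type*} [NormedAddCommGroup H] [InnerProductSpace ℝ H]
    [CompleteSpace H] [TopologicalSpace.SeparableSpace H] {u : ℕ → H} {C : ℝ}
    (hu : ∀ n, ‖u n‖ ≤ C) : ∃ (v : H) (φ : ℕ → ℕ), StrictMono φ ∧
      ∀ f : StrongDual ℝ H, Tendsto (fun n => f (u (φ n))) atTop (𝓝 (f v)) := by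
  obtain ⟨w, -, φ, hφ, hw⟩ := WeakDual.isSeqCompact_closedBall ℝ H 0 C
    (x := fun n => StrongDual.toWeakDual (InnerProductSpace.toDual ℝ H (u n)))
    (fun n => by
      change InnerProductSpace.toDual ℝ H (u n) ∈ Metric.closedBall 0 C
      simpa using hu n)
  refine ⟨(InnerProductSpace.toDual ℝ H).symm (WeakDual.toStrongDual w), φ, hφ, fun f => ?_⟩
  have h := (WeakBilin.tendsto_iff_forall_eval_tendsto _ (f := fun n =>
    StrongDual.toWeakDual (InnerProductSpace.toDual ℝ H (u (φ n))))
    (ContinuousLinearMap.coe_injective)).1 hw ((InnerProductSpace.toDual ℝ H).symm f)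
  have h1 : ∀ x : H, f x = inner ℝ x ((InnerProductSpace.toDual ℝ H).symm f) := fun x => by
    rw [real_inner_comm, InnerProductSpace.toDual_symm_apply]
  simp only [h1]
  rw [InnerProductSpace.toDual_symm_apply]
  exact h

/-- Closed convex sets are weakly sequentially closed. -/
theorem mem_of_weakly_tendsto {H : Type*} [NormedAddCommGroup H] [NormedSpace ℝ H] {s : Set H}
    (hc : Convex ℝ s) (hs : IsClosed s) {u : ℕ → H} {v : H}
    (hu : ∀ᶠ n in atTop, u n ∈ s)
    (hv : ∀ f : StrongDual ℝ H, Tendsto (fun n => f (u n)) atTop (𝓝 (f v))) : v ∈ s := by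
  by_contra hvs
  obtain ⟨f, c, h1, h2⟩ := geometric_hahn_banach_point_closed hc hs hvs
  have := ge_of_tendsto (hv f) (hu.mono fun n hn => (h2 _ hn).le)
  linarith

instance : TopologicalSpace.SeparableSpace (Lp PairSpace 2 (volume : Measure R3)) := by
  have : Fact ((2 : ℝ≥0∞) ≠ ∞) := ⟨by simp⟩
  infer_instance

/-- The Hilbert space in which the pairs `(γ, α̂)` live. -/
abbrev PairL2 : Type := Lp PairSpace 2 (volume : Measure R3)

/-- The free energy, shifted by an integrable function so that it is nonnegative. -/
def shiftedEnergy (μ T L : ℝ) (u : R3 → PairSpace) : ℝ≥0∞ :=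
  ∫⁻ p, ENNReal.ofReal (freeDensity μ T p (u p) + lowerBound L T p)

/-- The sublevel sets of the free energy. -/
def energySublevel (μ T L c : ℝ) : Set PairL2 :=
  {u | (∀ᵐ p, u p ∈ pairBall) ∧ shiftedEnergy μ T L u ≤ ENNReal.ofReal c}

theorem aemeasurable_freeDensity (μ : ℝ) {T : ℝ} (hT : 0 ≤ T) (L : ℝ) {u : R3 → PairSpace}
    (hu : AEStronglyMeasurable u) :
    AEStronglyMeasurable (fun p => freeDensity μ T p (u p) + lowerBound L T p) volume :=
  ((continuous_freeDensity μ T).comp_aestronglyMeasurable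
    (aestronglyMeasurable_id.prodMk hu)).add (integrable_lowerBound L hT).1

/-- The shift $|\mu|+T+K$ makes the integrand nonnegative on the ball, so `ENNReal.ofReal` is
additive there and convexity of the density passes to the integral. -/
theorem convex_energySublevel {μ T K c : ℝ} (hT : 0 ≤ T) (hK : 0 ≤ K) :
    Convex ℝ (energySublevel μ T (|μ| + T + K) c) := by
  intro u hu v hv s t hs ht hst
  have hadd := Lp.coeFn_add (s • u) (t • v)
  have hsu := Lp.coeFn_smul s u
  have htv := Lp.coeFn_smul t v
  have hcomb : ∀ᵐ p, (s • u + t • v : PairL2) p = s • u p + t • v p := by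
    filter_upwards [hadd, hsu, htv] with p h1 h2 h3
    rw [h1, Pi.add_apply, h2, h3]; rfl
  refine ⟨?_, ?_⟩
  · filter_upwards [hcomb, hu.1, hv.1] with p h1 h2 h3
    rw [h1]
    exact convex_pairBall h2 h3 hs ht hst
  · have hm := (aemeasurable_freeDensity μ hT (|μ| + T + K) (Lp.aestronglyMeasurable u))
      |>.aemeasurable.ennreal_ofReal
    calc shiftedEnergy μ T (|μ| + T + K) (s • u + t • v : PairL2)
        ≤ ∫⁻ p, (ENNReal.ofReal s *
              ENNReal.ofReal (freeDensity μ T p (u p) + lowerBound (|μ| + T + K) T p) +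
            ENNReal.ofReal t *
              ENNReal.ofReal (freeDensity μ T p (v p) + lowerBound (|μ| + T + K) T p)) := by
          refine lintegral_mono_ae ?_
          filter_upwards [hcomb, hu.1, hv.1] with p h1 h2 h3
          have hnn : ∀ {w}, w ∈ pairBall →
              0 ≤ freeDensity μ T p w + lowerBound (|μ| + T + K) T p := fun hw =>
            (mul_nonneg (by positivity) (fst_mem_of_mem_pairBall hw).1).trans
              (freeDensity_ge hT hK p hw)
          rw [h1, ← ENNReal.ofReal_mul hs, ← ENNReal.ofReal_mul ht,
            ← ENNReal.ofReal_add (mul_nonneg hs (hnn h2)) (mul_nonneg ht (hnn h3))]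
          refine ENNReal.ofReal_le_ofReal ?_
          have h4 := (freeDensity_convex hT p (μ := μ)).2 h2 h3 hs ht hst
          simp only [smul_eq_mul] at h4
          have h5 : lowerBound (|μ| + T + K) T p = s * lowerBound (|μ| + T + K) T p +
            t * lowerBound (|μ| + T + K) T p := by rw [← add_mul, hst, one_mul]
          linarith
      _ = ENNReal.ofReal s * shiftedEnergy μ T (|μ| + T + K) u +
            ENNReal.ofReal t * shiftedEnergy μ T (|μ| + T + K) v := by
          rw [lintegral_add_left' (hm.const_mul _), lintegral_const_mul' _ _ (by simp),
            lintegral_const_mul' _ _ (by simp)]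
          rfl
      _ ≤ ENNReal.ofReal s * ENNReal.ofReal c + ENNReal.ofReal t * ENNReal.ofReal c := by
          gcongr
          exacts [hu.2, hv.2]
      _ = ENNReal.ofReal c := by
          rw [← add_mul, ← ENNReal.ofReal_add hs ht, hst, ENNReal.ofReal_one, one_mul]

/-- An $L^2$ convergent sequence has an almost everywhere convergent subsequence; the ball is
closed, the density is continuous, and Fatou handles the energy. -/
theorem isClosed_energySublevel {μ T : ℝ} (hT : 0 ≤ T) (L c : ℝ) :
    IsClosed (energySublevel μ T L c) := by
  refine IsSeqClosed.isClosed fun u v hu hv => ?_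
  obtain ⟨φ, hφ, hae⟩ := (tendstoInMeasure_of_tendsto_Lp hv).exists_seq_tendsto_ae
  refine ⟨?_, ?_⟩
  · have h := ae_all_iff.2 fun n => (hu (φ n)).1
    filter_upwards [hae, h] with p h1 h2
    exact Metric.isClosed_closedBall.mem_of_tendsto h1 (Eventually.of_forall h2)
  · have hlim : ∀ᵐ p, ENNReal.ofReal (freeDensity μ T p (v p) + lowerBound L T p) =
        liminf (fun n => ENNReal.ofReal
          (freeDensity μ T p (u (φ n) p) + lowerBound L T p)) atTop := by
      filter_upwards [hae] with p h1
      have h2 : Tendsto (fun n => freeDensity μ T p (u (φ n) p)) atTop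
          (𝓝 (freeDensity μ T p (v p))) :=
        ((continuous_freeDensity_right μ T p).tendsto (v p)).comp h1
      exact (ENNReal.tendsto_ofReal (h2.add_const (lowerBound L T p))).liminf_eq.symm
    have hfatou : shiftedEnergy μ T L v ≤
        liminf (fun n => shiftedEnergy μ T L (u (φ n))) atTop := by
      unfold shiftedEnergy
      rw [lintegral_congr_ae hlim]
      exact lintegral_liminf_le' fun n => (aemeasurable_freeDensity μ hT L
        (Lp.aestronglyMeasurable (u (φ n)))).aemeasurable.ennreal_ofReal
    refine hfatou.trans (liminf_le_of_le (by isBoundedDefault) fun b hb => ?_)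
    obtain ⟨n, hn⟩ := hb.exists
    exact hn.trans (hu (φ n)).2

/-! ### Admissible pairs as elements of the Hilbert space -/

/-- The pair `(γ, α̂)` associated with `(γ, α)`. -/
def pairOf (x : (R3 → ℝ) × L2) (p : R3) : PairSpace := WithLp.toLp 2 (x.1 p, hat x.2 p)

theorem pairOf_fst (x : (R3 → ℝ) × L2) (p : R3) : (pairOf x p).fst = x.1 p := rfl

theorem pairOf_snd (x : (R3 → ℝ) × L2) (p : R3) : (pairOf x p).snd = hat x.2 p := rfl

theorem kinetic_le (α : L2) :
    kinetic α ≤ ∫⁻ p, ENNReal.ofReal (‖p‖ ^ 2) * ‖hat α p‖ₑ ^ 2 := by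
  rw [← lintegral_mul_hat_sq, kinetic]
  refine lintegral_mono fun ξ => ?_
  gcongr
  rw [norm_smul, Real.norm_of_nonneg Real.two_pi_pos.le]
  refine le_mul_of_one_le_left (norm_nonneg _) ?_
  linarith [Real.pi_gt_three]

section Admissible

variable {x : (R3 → ℝ) × L2}

theorem pairOf_mem_pairBall (hx : x ∈ admissible) : ∀ᵐ p, pairOf x p ∈ pairBall :=
  hx.2.2.2.mono fun _ hp => mem_pairBall.2 hp

theorem aestronglyMeasurable_fst (hx : x ∈ admissible) : AEStronglyMeasurable x.1 volume := by
  have h : x.1 = fun p => (1 + ‖p‖ ^ 2)⁻¹ * ((1 + ‖p‖ ^ 2) * x.1 p) := by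
    funext p
    have : (1 + ‖p‖ ^ 2) ≠ 0 := by positivity
    field_simp
  rw [h]
  refine AEStronglyMeasurable.mul (Continuous.aestronglyMeasurable ?_) hx.1.1
  refine Continuous.inv₀ (by fun_prop) fun p => by positivity

theorem aestronglyMeasurable_pairOf (hx : x ∈ admissible) :
    AEStronglyMeasurable (pairOf x) volume :=
  (WithLp.prod_continuous_toLp 2 ℝ ℂ).comp_aestronglyMeasurable
    ((aestronglyMeasurable_fst hx).prodMk (aestronglyMeasurable_hat x.2))

theorem integrable_mul_fst (hx : x ∈ admissible) {f : R3 → ℝ} (hf : Continuous f) {C : ℝ}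
    (hfC : ∀ p, |f p| ≤ C * (1 + ‖p‖ ^ 2)) : Integrable fun p => f p * x.1 p := by
  refine (hx.1.const_mul C).mono' (hf.aestronglyMeasurable.mul (aestronglyMeasurable_fst hx)) ?_
  filter_upwards [hx.2.1] with p hp
  rw [norm_mul, Real.norm_eq_abs, Real.norm_of_nonneg hp.1, ← mul_assoc]
  exact mul_le_mul_of_nonneg_right (hfC p) hp.1

theorem integrable_kinetic (hx : x ∈ admissible) : Integrable fun p => ‖p‖ ^ 2 * x.1 p :=
  integrable_mul_fst hx (by fun_prop) (C := 1) fun p => by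
    rw [abs_of_nonneg (by positivity)]; linarith

theorem integrable_fst (hx : x ∈ admissible) : Integrable x.1 := by
  simpa using integrable_mul_fst hx (f := fun _ => 1) (by fun_prop) (C := 1) fun p => by
    rw [abs_one]; nlinarith [sq_nonneg ‖p‖]

theorem integrable_kinetic_sub (hx : x ∈ admissible) (μ : ℝ) :
    Integrable fun p => (‖p‖ ^ 2 - μ) * x.1 p :=
  ((integrable_kinetic hx).sub ((integrable_fst hx).const_mul μ)).congr
    (Eventually.of_forall fun p => by simp only [Pi.sub_apply]; ring)

theorem integrable_entropy (hx : x ∈ admissible) :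
    Integrable fun p => entropyFn (sFn x.1 x.2 p) := by
  have hb : Integrable fun p => ‖p‖ ^ 2 * x.1 p + x.1 p + Real.exp (-(1 * ‖p‖ ^ 2)) :=
    ((integrable_kinetic hx).add (integrable_fst hx)).add (integrable_exp_neg_mul_norm_sq one_pos)
  refine hb.mono' ?_ ?_
  · simp only [entropyFn_sFn]
    exact continuous_pairEntropy.comp_aestronglyMeasurable (aestronglyMeasurable_pairOf hx)
  · filter_upwards [pairOf_mem_pairBall hx] with p hp
    rw [entropyFn_sFn]
    change ‖pairEntropy (pairOf x p)‖ ≤ _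
    rw [Real.norm_of_nonneg (pairEntropy_nonneg hp)]
    have h := pairEntropy_le hp (‖p‖ ^ 2)
    rw [pairOf_fst] at h
    rw [one_mul]
    linarith

theorem enorm_hat_sq_le (hx : x ∈ admissible) :
    ∀ᵐ p, ‖hat x.2 p‖ₑ ^ 2 ≤ ENNReal.ofReal (x.1 p) := by
  filter_upwards [hx.2.1, hx.2.2.2] with p h1 h2
  rw [← ofReal_norm, ← ENNReal.ofReal_pow (norm_nonneg _)]
  refine ENNReal.ofReal_le_ofReal (h2.trans ?_)
  nlinarith

/-- Here $|\hat\alpha|^2\le\gamma(1-\gamma)\le\gamma$, so the second moment of $\gamma$ bounds the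
kinetic energy of $\alpha$. -/
theorem kinetic_le_integral (hx : x ∈ admissible) :
    kinetic x.2 ≤ ENNReal.ofReal (∫ p, ‖p‖ ^ 2 * x.1 p) := by
  rw [ofReal_integral_eq_lintegral_ofReal (integrable_kinetic hx)
    (hx.2.1.mono fun p hp => mul_nonneg (by positivity) hp.1)]
  refine (kinetic_le x.2).trans (lintegral_mono_ae ?_)
  filter_upwards [enorm_hat_sq_le hx] with p hp
  rw [ENNReal.ofReal_mul (by positivity)]
  gcongr

theorem lintegral_enorm_sq_le_integral (hx : x ∈ admissible) :
    ∫⁻ r, ‖x.2 r‖ₑ ^ 2 ≤ ENNReal.ofReal (∫ p, x.1 p) := by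
  rw [ofReal_integral_eq_lintegral_ofReal (integrable_fst hx) (hx.2.1.mono fun _ hp => hp.1),
    ← lintegral_hat_sq]
  exact lintegral_mono_ae (enorm_hat_sq_le hx)

theorem integral_kinetic_nonneg (hx : x ∈ admissible) : 0 ≤ ∫ p, ‖p‖ ^ 2 * x.1 p :=
  integral_nonneg_of_ae (hx.2.1.mono fun p hp => mul_nonneg (by positivity) hp.1)

theorem integral_fst_nonneg (hx : x ∈ admissible) : 0 ≤ ∫ p, x.1 p :=
  integral_nonneg_of_ae (hx.2.1.mono fun _ hp => hp.1)

theorem memLp_pairOf (hx : x ∈ admissible) : MemLp (pairOf x) 2 ∧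
    ∫⁻ p, ‖pairOf x p‖ₑ ^ 2 ≤ ENNReal.ofReal (∫ p, x.1 p) := by
  have h : ∫⁻ p, ‖pairOf x p‖ₑ ^ 2 ≤ ENNReal.ofReal (∫ p, x.1 p) := by
    rw [ofReal_integral_eq_lintegral_ofReal (integrable_fst hx) (hx.2.1.mono fun _ hp => hp.1)]
    refine lintegral_mono_ae ?_
    filter_upwards [pairOf_mem_pairBall hx] with p hp
    rw [← ofReal_norm, ← ENNReal.ofReal_pow (norm_nonneg _)]
    refine ENNReal.ofReal_le_ofReal ?_
    rw [norm_pair_sq]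
    have h2 := mem_pairBall.1 hp
    rw [pairOf_fst, pairOf_snd] at h2 ⊢
    -- In the ball, $\gamma^2+|\hat\alpha|^2\le\gamma$, so the $L^1$ norm of $\gamma$ bounds the
    -- squared Hilbert norm.
    nlinarith
  exact ⟨(memLp_two_iff (aestronglyMeasurable_pairOf hx)).2 (h.trans_lt (by simp)), h⟩

theorem integrable_freeDensity (hx : x ∈ admissible) (μ T : ℝ) :
    Integrable fun p => freeDensity μ T p (pairOf x p) := by
  have h := (integrable_kinetic_sub hx μ).sub ((integrable_entropy hx).const_mul T)
  refine h.congr (Eventually.of_forall fun p => ?_)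
  simp only [Pi.sub_apply, entropyFn_sFn]
  rfl

theorem functional_eq (hx : x ∈ admissible) (V : R3 → ℝ) (μ T : ℝ) :
    functional V μ T x = (∫ p, freeDensity μ T p (pairOf x p)) + ∫ r, ‖x.2 r‖ ^ 2 * V r := by
  have h : ∫ p, freeDensity μ T p (pairOf x p) =
      (∫ p, (‖p‖ ^ 2 - μ) * x.1 p) - T * entropy x.1 x.2 := by
    rw [entropy, ← integral_const_mul, ← integral_sub (integrable_kinetic_sub hx μ)
      ((integrable_entropy hx).const_mul T)]
    refine integral_congr_ae (Eventually.of_forall fun p => ?_)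
    simp only [entropyFn_sFn]
    rfl
  rw [functional, h]; ring

theorem shiftedEnergy_pairOf (hx : x ∈ admissible) {μ T K : ℝ} (hT : 0 ≤ T) (hK : 0 ≤ K) :
    shiftedEnergy μ T (|μ| + T + K) (pairOf x) =
      ENNReal.ofReal ((∫ p, freeDensity μ T p (pairOf x p)) +
        ∫ p, lowerBound (|μ| + T + K) T p) := by
  rw [← integral_add (integrable_freeDensity hx μ T) (integrable_lowerBound _ hT)]
  refine (ofReal_integral_eq_lintegral_ofReal
    ((integrable_freeDensity hx μ T).add (integrable_lowerBound _ hT)) ?_).symm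
  filter_upwards [pairOf_mem_pairBall hx] with p hp
  exact (mul_nonneg (by positivity) (fst_mem_of_mem_pairBall hp).1).trans
    (freeDensity_ge hT hK p hp)

theorem integral_freeDensity_ge (hx : x ∈ admissible) {μ T K : ℝ} (hT : 0 ≤ T) (hK : 0 ≤ K) :
    (∫ p, ‖p‖ ^ 2 * x.1 p) / 2 + K * ∫ p, x.1 p ≤
      (∫ p, freeDensity μ T p (pairOf x p)) + ∫ p, lowerBound (|μ| + T + K) T p := by
  rw [← integral_add (integrable_freeDensity hx μ T) (integrable_lowerBound _ hT),
    ← integral_div, ← integral_const_mul,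
    ← integral_add ((integrable_kinetic hx).div_const 2) ((integrable_fst hx).const_mul K)]
  refine integral_mono_ae (((integrable_kinetic hx).div_const 2).add
    ((integrable_fst hx).const_mul K))
    ((integrable_freeDensity hx μ T).add (integrable_lowerBound _ hT)) ?_
  filter_upwards [pairOf_mem_pairBall hx] with p hp
  have h := freeDensity_ge (μ := μ) hT hK p hp
  refine le_trans (le_of_eq ?_) h
  rw [pairOf_fst]; ring

end Admissible

/-! ### Weak convergence of the pairs gives pointwise convergence of low frequency parts -/

theorem memLp_snd (u : PairL2) : MemLp (fun p => (u p).snd) 2 := by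
  refine (Lp.memLp u).of_le ?_ (Eventually.of_forall fun p => ?_)
  · exact (show Continuous fun w : PairSpace => w.snd by fun_prop).comp_aestronglyMeasurable
      (Lp.aestronglyMeasurable u)
  · refine abs_le_of_sq_le_sq' ?_ (norm_nonneg _) |>.2
    rw [norm_pair_sq]
    linarith [sq_nonneg (u p).fst]

/-- `PairL2` is a real Hilbert space, so its functionals see one real part at a time: this one is
the inner product with $(0,\bar k)$. The imaginary part is recovered by applying the lemma to $-ik$.
-/
theorem exists_dual_eq_re_integral {k : R3 → ℂ} (hk : MemLp k 2) :
    ∃ f : StrongDual ℝ PairL2, ∀ u : PairL2, f u = (∫ p, k p * (u p).snd).re := by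
  have hm : AEStronglyMeasurable
      (fun p => (WithLp.toLp 2 ((0 : ℝ), star (k p)) : PairSpace)) volume :=
    (WithLp.prod_continuous_toLp 2 ℝ ℂ).comp_aestronglyMeasurable
      (aestronglyMeasurable_const.prodMk (continuous_star.comp_aestronglyMeasurable hk.1))
  have hw : MemLp (fun p => (WithLp.toLp 2 ((0 : ℝ), star (k p)) : PairSpace)) 2 := by
    refine hk.of_le hm (Eventually.of_forall fun p => ?_)
    refine abs_le_of_sq_le_sq' ?_ (norm_nonneg _) |>.2
    rw [norm_pair_sq]
    simp
  refine ⟨innerSL ℝ (hw.toLp : PairL2), fun u => ?_⟩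
  have hi : Integrable fun p => k p * (u p).snd := hk.integrable_mul (memLp_snd u)
  rw [innerSL_apply_apply, L2.inner_def, ← Complex.reCLM_apply,
    ← Complex.reCLM.integral_comp_comm hi]
  refine integral_congr_ae ?_
  filter_upwards [hw.coeFn_toLp] with p hp
  rw [hp, WithLp.prod_inner_apply]
  simp only [Complex.inner, inner_zero_left, zero_add, RCLike.star_def, Complex.conj_conj,
    Complex.reCLM_apply]
  rw [mul_comm]
  rfl

theorem tendsto_integral_mul_snd {k : R3 → ℂ} (hk : MemLp k 2) {us : ℕ → PairL2} {u : PairL2}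
    (hu : ∀ f : StrongDual ℝ PairL2, Tendsto (fun n => f (us n)) atTop (𝓝 (f u))) :
    Tendsto (fun n => ∫ p, k p * (us n p).snd) atTop (𝓝 (∫ p, k p * (u p).snd)) := by
  obtain ⟨f, hf⟩ := exists_dual_eq_re_integral hk
  obtain ⟨g, hg⟩ := exists_dual_eq_re_integral (hk.const_mul (-Complex.I))
  have hre := hu f
  have him := hu g
  have h2 : ∀ v : PairL2, g v = (∫ p, k p * (v p).snd).im := fun v => by
    rw [hg]
    simp only [mul_assoc]
    rw [integral_const_mul]
    simp
  simp only [hf] at hre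
  simp only [h2] at him
  have h := ((Complex.continuous_ofReal.tendsto _).comp hre).add
    (((Complex.continuous_ofReal.tendsto _).comp him).mul_const Complex.I)
  simpa only [Function.comp_def, Complex.re_add_im] using h

/-- The kernel that produces the low frequency part from the Fourier transform. -/
def lowKernel (R : ℝ) (x : R3) : R3 → ℂ :=
  (Metric.closedBall (0 : R3) (2 * Real.pi * R)).indicator
    fun p => Complex.exp ((inner ℝ p x : ℝ) * Complex.I)

theorem memLp_lowKernel (R : ℝ) (x : R3) : MemLp (lowKernel R x) 2 := by
  have h : MemLp ((Metric.closedBall (0 : R3) (2 * Real.pi * R)).indicator fun _ => (1 : ℂ)) 2 :=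
    memLp_indicator_const 2 measurableSet_closedBall 1 (Or.inr measure_closedBall_lt_top.ne)
  refine h.of_le (AEStronglyMeasurable.indicator
    (Continuous.aestronglyMeasurable (by fun_prop)) measurableSet_closedBall)
    (Eventually.of_forall fun p => ?_)
  rw [lowKernel, norm_indicator_eq_indicator_norm, norm_indicator_eq_indicator_norm]
  simp [Complex.norm_exp_ofReal_mul_I]

/-- After $p=2\pi\xi$, the value at $x$ is a pairing of $\hat\alpha$ with a bounded, compactly
supported kernel, which lies in $L^2$. -/
theorem lowPart_eq_integral_hat (α : L2) (R : ℝ) (x : R3) :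
    lowPart α R x = hatConst⁻¹ * (((|((2 * Real.pi) ^ 3)⁻¹| : ℝ) : ℂ) *
      ∫ p, lowKernel R x p * hat α p) := by
  have h := Measure.integral_comp_smul (volume : Measure R3)
    (fun p => lowKernel R x p * hat α p) (2 * Real.pi)
  rw [finrank_euclideanSpace_fin, Complex.real_smul] at h
  rw [← h, ← integral_const_mul, lowPart, Real.fourierInv_eq']
  refine integral_congr_ae (Eventually.of_forall fun ξ => ?_)
  simp only [hat_two_pi_smul, smul_eq_mul, lowKernel]
  have hpi := Real.two_pi_pos
  by_cases hξ : ‖ξ‖ ≤ R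
  · rw [Set.indicator_of_mem (by simpa using hξ), Set.indicator_of_mem, inner_smul_left]
    · field_simp [hatConst_ne_zero]
      simp only [conj_trivial, Complex.ofReal_mul, Complex.ofReal_ofNat]
      ring_nf
    · rw [mem_closedBall_zero_iff, norm_smul, Real.norm_of_nonneg hpi.le]
      gcongr
  · rw [Set.indicator_of_notMem (by simpa using hξ), Set.indicator_of_notMem]
    · simp
    · rw [mem_closedBall_zero_iff, norm_smul, Real.norm_of_nonneg hpi.le]
      exact fun h => hξ (le_of_mul_le_mul_left h hpi)

theorem tendsto_lowPart {us : ℕ → PairL2} {u : PairL2} {αs : ℕ → L2} {α : L2}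
    (hu : ∀ f : StrongDual ℝ PairL2, Tendsto (fun n => f (us n)) atTop (𝓝 (f u)))
    (hs : ∀ n, (fun p => (us n p).snd) =ᵐ[volume] hat (αs n))
    (hα : (fun p => (u p).snd) =ᵐ[volume] hat α) (R : ℝ) (x : R3) :
    Tendsto (fun n => lowPart (αs n) R x) atTop (𝓝 (lowPart α R x)) := by
  have hcongr : ∀ (v : PairL2) (β : L2), (fun p => (v p).snd) =ᵐ[volume] hat β →
      ∫ p, lowKernel R x p * hat β p = ∫ p, lowKernel R x p * (v p).snd := fun v β h =>
    integral_congr_ae (h.mono fun p hp => by simp only at hp ⊢; rw [hp])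
  simp only [lowPart_eq_integral_hat, hcongr _ _ hα, fun n => hcongr _ _ (hs n)]
  exact ((tendsto_integral_mul_snd (memLp_lowKernel R x) hu).const_mul _).const_mul _

/-! ### Coercivity and existence of a minimizer -/

theorem zero_mem_admissible : ((0 : R3 → ℝ), (0 : L2)) ∈ admissible := by
  have h0 : ∀ᵐ p, hat 0 p = 0 := by
    have h := lintegral_hat_sq 0
    rw [lintegral_enorm_sq_eq, enorm_zero, zero_pow two_ne_zero,
      lintegral_eq_zero_iff' ((aestronglyMeasurable_hat 0).enorm.pow_const 2)] at h
    filter_upwards [h] with p hp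
    simpa using hp
  refine ⟨by simp, by simp, memSobolev_of_lintegral 0 ?_, ?_⟩
  · rw [lintegral_congr_ae (g := fun _ => 0) (h0.mono fun p hp => by simp [hp])]
    simp
  · filter_upwards [h0] with p hp
    simp [hp]

/-- Every pair of finite free energy comes from an admissible pair. -/
theorem exists_admissible_of_mem {μ T K c : ℝ} (hT : 0 ≤ T) (hK : 1 ≤ K) {u : PairL2}
    (hu : u ∈ energySublevel μ T (|μ| + T + K) c) :
    ∃ x ∈ admissible, pairOf x =ᵐ[volume] u := by
  obtain ⟨hball, hE⟩ := hu
  obtain ⟨α, hα⟩ := exists_hat_ae_eq (memLp_snd u)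
  have hpos : ∀ᵐ p, 0 ≤ (u p).fst ∧ (u p).fst ≤ 1 :=
    hball.mono fun p hp => fst_mem_of_mem_pairBall hp
  have hmeas : AEStronglyMeasurable (fun p => (1 + ‖p‖ ^ 2) * (u p).fst) volume :=
    (Continuous.aestronglyMeasurable (by fun_prop)).mul
      ((show Continuous fun w : PairSpace => w.fst by fun_prop).comp_aestronglyMeasurable
        (Lp.aestronglyMeasurable u))
  have hlt : ∫⁻ p, ENNReal.ofReal ((1 + ‖p‖ ^ 2) * (u p).fst) < ∞ := by
    -- Since $K\ge1$, twice $p^2/2+K$ dominates $1+p^2$, so finite shifted energy gives the required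
    -- moments of $\gamma$.
    have h1 : ∫⁻ p, ENNReal.ofReal ((1 + ‖p‖ ^ 2) * (u p).fst) ≤
        ∫⁻ p, ENNReal.ofReal 2 * ENNReal.ofReal
          (freeDensity μ T p (u p) + lowerBound (|μ| + T + K) T p) := by
      refine lintegral_mono_ae ?_
      filter_upwards [hball, hpos] with p hp hp0
      have h := freeDensity_ge (μ := μ) hT (zero_le_one.trans hK) p hp
      rw [← ENNReal.ofReal_mul zero_le_two]
      refine ENNReal.ofReal_le_ofReal ?_
      nlinarith [mul_le_mul_of_nonneg_right hK hp0.1]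
    refine h1.trans_lt ?_
    rw [lintegral_const_mul' _ _ (by simp)]
    exact ENNReal.mul_lt_top (by simp) (hE.trans_lt (by simp))
  have hint : Integrable (fun p => (1 + ‖p‖ ^ 2) * (u p).fst) := by
    refine ⟨hmeas, ?_⟩
    rw [hasFiniteIntegral_iff_ofReal (hpos.mono fun p hp => mul_nonneg (by positivity) hp.1)]
    exact hlt
  have hle : ∀ᵐ p, ‖hat α p‖ ^ 2 ≤ (u p).fst * (1 - (u p).fst) := by
    filter_upwards [hα, hball] with p h1 h2
    rw [h1]
    exact mem_pairBall.1 h2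
  refine ⟨(fun p => (u p).fst, α), ⟨hint, hpos, memSobolev_of_lintegral α ?_, hle⟩, ?_⟩
  · refine lt_of_le_of_lt (lintegral_mono_ae ?_) hlt
    filter_upwards [hle, hpos] with p h1 h2
    rw [← ofReal_norm, ← ENNReal.ofReal_pow (norm_nonneg _), ← ENNReal.ofReal_mul (by positivity)]
    refine ENNReal.ofReal_le_ofReal ?_
    have h3 : ‖hat α p‖ ^ 2 ≤ (u p).fst := by nlinarith
    have h4 := mul_le_mul_of_nonneg_left h3 (sq_nonneg ‖p‖)
    nlinarith
  · filter_upwards [hα] with p hp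
    rw [pairOf, hp]
    rfl

/-- The potential costs at most a quarter of the second moment of $\gamma$, plus $M$ times its mass
and a constant. Taking $K=M+1$ leaves a quarter of the second moment and one unit of mass. -/
theorem exists_coercive {V : R3 → ℝ} (hV : MemLp V (3 / 2 : ℝ≥0∞) volume) (μ : ℝ) {T : ℝ}
    (hT : 0 ≤ T) : ∃ C : ℝ, ∀ x ∈ admissible,
      (∫ p, ‖p‖ ^ 2 * x.1 p) / 4 + ∫ p, x.1 p ≤ functional V μ T x + C := by
  obtain ⟨M, hM, h⟩ := abs_potential_le hV (ε := 1 / 4) (by norm_num)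
  refine ⟨1 / 4 + ∫ p, lowerBound (|μ| + T + (M + 1)) T p, fun x hx => ?_⟩
  have hP := integral_kinetic_nonneg hx
  have hW := h x.2 ((∫ p, ‖p‖ ^ 2 * x.1 p) + 1) (∫ p, x.1 p) (by positivity)
    (integral_fst_nonneg hx)
    ((kinetic_le_integral hx).trans (ENNReal.ofReal_le_ofReal (by linarith)))
    (lintegral_enorm_sq_le_integral hx)
  have hE := integral_freeDensity_ge (μ := μ) hx hT (by positivity : 0 ≤ M + 1)
  rw [functional_eq hx]
  linarith [neg_le_of_abs_le hW]

theorem pairOf_mem_energySublevel {x : (R3 → ℝ) × L2} (hx : x ∈ admissible) {V : R3 → ℝ}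
    {μ T K c : ℝ} (hT : 0 ≤ T) (hK : 0 ≤ K)
    (hc : functional V μ T x - (∫ r, ‖x.2 r‖ ^ 2 * V r) +
      ∫ p, lowerBound (|μ| + T + K) T p ≤ c) :
    (memLp_pairOf hx).1.toLp ∈ energySublevel μ T (|μ| + T + K) c := by
  have hco := (memLp_pairOf hx).1.coeFn_toLp
  refine ⟨?_, ?_⟩
  · filter_upwards [hco, pairOf_mem_pairBall hx] with p h1 h2
    rwa [h1]
  · have h1 : shiftedEnergy μ T (|μ| + T + K) ((memLp_pairOf hx).1.toLp : PairL2) =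
        shiftedEnergy μ T (|μ| + T + K) (pairOf x) :=
      lintegral_congr_ae (hco.mono fun p hp => by simp only [hp])
    rw [h1, shiftedEnergy_pairOf hx hT hK]
    refine ENNReal.ofReal_le_ofReal ?_
    rw [functional_eq hx] at hc
    linarith

/-- Sequences of bounded energy converge, along a subsequence, weakly to an admissible pair,
and the functional is lower semicontinuous in this limit. -/
theorem exists_admissible_le_of_tendsto {V : R3 → ℝ} (hV : MemLp V (3 / 2 : ℝ≥0∞) volume)
    (μ : ℝ) {T : ℝ} (hT : 0 ≤ T) {xs : ℕ → (R3 → ℝ) × L2} (hxs : ∀ n, xs n ∈ admissible) {m : ℝ}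
    (hm : Tendsto (fun n => functional V μ T (xs n)) atTop (𝓝 m)) :
    ∃ x ∈ admissible, functional V μ T x ≤ m := by
  obtain ⟨C, hC⟩ := exists_coercive hV μ hT
  obtain ⟨c₀, hc₀⟩ := hm.bddAbove_range
  have hF : ∀ n, functional V μ T (xs n) ≤ c₀ := fun n => hc₀ ⟨n, rfl⟩
  have hPn : ∀ n, ∫ p, ‖p‖ ^ 2 * (xs n).1 p ≤ 4 * (c₀ + C) := fun n => by
    linarith [hC _ (hxs n), hF n, integral_fst_nonneg (hxs n)]
  have hNn : ∀ n, ∫ p, (xs n).1 p ≤ c₀ + C := fun n => by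
    linarith [hC _ (hxs n), hF n, integral_kinetic_nonneg (hxs n)]
  have hcC : 0 ≤ c₀ + C := (integral_fst_nonneg (hxs 0)).trans (hNn 0)
  set us : ℕ → PairL2 := fun n => (memLp_pairOf (hxs n)).1.toLp with hus
  have husae : ∀ n, us n =ᵐ[volume] pairOf (xs n) := fun n =>
    (memLp_pairOf (hxs n)).1.coeFn_toLp
  have hnorm : ∀ n, ‖us n‖ ≤ Real.sqrt (c₀ + C) := fun n => by
    refine Real.le_sqrt_of_sq_le ?_
    have h1 := lintegral_enorm_sq_eq (us n)
    rw [lintegral_congr_ae ((husae n).mono fun p hp => by rw [hp])] at h1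
    have h2 := h1.symm.trans_le ((memLp_pairOf (hxs n)).2.trans
      (ENNReal.ofReal_le_ofReal (hNn n)))
    rwa [← ofReal_norm, ← ENNReal.ofReal_pow (norm_nonneg _),
      ENNReal.ofReal_le_ofReal_iff hcC] at h2
  obtain ⟨u, φ, hφ, hu⟩ := exists_weakly_convergent_subseq hnorm
  set H := ∫ p, lowerBound (|μ| + T + 1) T p with hH
  obtain ⟨M, hM, hW⟩ := abs_potential_le hV one_pos
  set A₀ := 4 * (c₀ + C) + 1 with hA₀
  have hkin : ∀ n, kinetic (xs n).2 ≤ ENNReal.ofReal A₀ := fun n =>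
    (kinetic_le_integral (hxs n)).trans (ENNReal.ofReal_le_ofReal (by linarith [hPn n]))
  have hmass : ∀ n, ∫⁻ r, ‖(xs n).2 r‖ₑ ^ 2 ≤ ENNReal.ofReal A₀ := fun n =>
    (lintegral_enorm_sq_le_integral (hxs n)).trans
      (ENNReal.ofReal_le_ofReal (by linarith [hNn n]))
  -- The weak limit inherits every bound on the free energy that holds eventually along the
  -- subsequence.
  have hmem : ∀ {c}, (∀ᶠ n in atTop, functional V μ T (xs (φ n)) -
      (∫ r, ‖(xs (φ n)).2 r‖ ^ 2 * V r) + H ≤ c) → u ∈ energySublevel μ T (|μ| + T + 1) c :=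
    fun hc => mem_of_weakly_tendsto (convex_energySublevel hT zero_le_one)
      (isClosed_energySublevel hT _ _)
      (hc.mono fun n hn => pairOf_mem_energySublevel (hxs (φ n)) hT zero_le_one hn) hu
  -- A crude level comes first: it only serves to identify the limit with an admissible pair.
  have hu₀ : u ∈ energySublevel μ T (|μ| + T + 1) (c₀ + (1 * A₀ + M * A₀) + H) := by
    refine hmem (Eventually.of_forall fun n => ?_)
    have h1 := hW (xs (φ n)).2 A₀ A₀ (by positivity) (by positivity) (hkin _) (hmass _)
    linarith [neg_le_of_abs_le h1, hF (φ n)]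
  obtain ⟨x, hx, hxu⟩ := exists_admissible_of_mem hT le_rfl hu₀
  refine ⟨x, hx, ?_⟩
  -- $A_0$ bounds the sequence; adding the moments of the limit gives one bound valid for both.
  set A := A₀ + (∫ p, ‖p‖ ^ 2 * x.1 p) + ∫ p, x.1 p with hA
  have hP := integral_kinetic_nonneg hx
  have hN := integral_fst_nonneg hx
  have hA₀A : A₀ ≤ A := by linarith
  have hlim : Tendsto (fun n => ∫ r, ‖(xs (φ n)).2 r‖ ^ 2 * V r) atTop
      (𝓝 (∫ r, ‖x.2 r‖ ^ 2 * V r)) := by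
    refine tendsto_potential hV (A := A) (by positivity)
      (fun n => (hkin _).trans (ENNReal.ofReal_le_ofReal hA₀A))
      (fun n => (hmass _).trans (ENNReal.ofReal_le_ofReal hA₀A))
      ((kinetic_le_integral hx).trans (ENNReal.ofReal_le_ofReal (by linarith)))
      ((lintegral_enorm_sq_le_integral hx).trans (ENNReal.ofReal_le_ofReal (by linarith)))
      (tendsto_lowPart hu (fun n => ?_) ?_)
    · exact (husae (φ n)).mono fun p hp => by simp only [hp, pairOf_snd]
    · exact hxu.mono fun p hp => by simp only [← hp, pairOf_snd]
  have hJ := ((hm.comp hφ.tendsto_atTop).sub hlim).add_const H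
  refine le_of_forall_pos_le_add fun ε hε => ?_
  -- The sharp level: the potential energies now converge, so the free energies are eventually
  -- within $\varepsilon$ of $m$ minus the limiting potential energy.
  have hue := hmem (c := m - (∫ r, ‖x.2 r‖ ^ 2 * V r) + H + ε)
    ((hJ.eventually_lt_const (lt_add_of_pos_right _ hε)).mono fun n hn => le_of_lt hn)
  have hse : shiftedEnergy μ T (|μ| + T + 1) u = shiftedEnergy μ T (|μ| + T + 1) (pairOf x) :=
    lintegral_congr_ae (hxu.mono fun p hp => by simp only [hp])
  have h1 := hue.2
  -- `ENNReal.ofReal` truncates at zero, so the level must be known to be nonnegative before the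
  -- bound can be read in $\mathbb{R}$.
  have hnonneg : 0 ≤ m - (∫ r, ‖x.2 r‖ ^ 2 * V r) + H := by
    refine ge_of_tendsto hJ (Eventually.of_forall fun n => ?_)
    have h0 := integral_freeDensity_ge (μ := μ) (hxs (φ n)) hT zero_le_one
    have hP := integral_kinetic_nonneg (hxs (φ n))
    have hN := integral_fst_nonneg (hxs (φ n))
    simp only [Function.comp, functional_eq (hxs (φ n))]
    linarith
  rw [hse, shiftedEnergy_pairOf hx hT zero_le_one,
    ENNReal.ofReal_le_ofReal_iff (by linarith)] at h1
  rw [functional_eq hx]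
  linarith

end BCS

end

theorem mainTheorem9 (V : BCS.R3 → ℝ) (hV : MemLp V (3 / 2 : ℝ≥0∞) volume)
    (μ T : ℝ) (hT : 0 ≤ T) :
    -- all the integrals in the functional converge absolutely on the admissible set
    (∀ x ∈ BCS.admissible,
      Integrable (fun p : BCS.R3 => (‖p‖ ^ 2 - μ) * x.1 p) ∧
      Integrable (fun r : BCS.R3 => ‖x.2 r‖ ^ 2 * V r) ∧
      Integrable (fun p : BCS.R3 => BCS.entropyFn (BCS.sFn x.1 x.2 p))) ∧
    -- and the functional has a minimizer there
    ∃ x ∈ BCS.admissible, IsMinOn (BCS.functional V μ T) BCS.admissible x := by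
  refine ⟨fun x hx => ⟨BCS.integrable_kinetic_sub hx μ, BCS.integrable_potential hV x.2
    ((BCS.kinetic_le_integral hx).trans_lt ENNReal.ofReal_lt_top), BCS.integrable_entropy hx⟩, ?_⟩
  obtain ⟨C, hC⟩ := BCS.exists_coercive hV μ hT
  have hbdd : BddBelow (BCS.functional V μ T '' BCS.admissible) := by
    refine ⟨-C, ?_⟩
    rintro _ ⟨x, hx, rfl⟩
    linarith [hC x hx, BCS.integral_kinetic_nonneg hx, BCS.integral_fst_nonneg hx]
  obtain ⟨y, -, hy, hmem⟩ := exists_seq_tendsto_sInf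
    (Set.Nonempty.image (BCS.functional V μ T) ⟨_, BCS.zero_mem_admissible⟩) hbdd
  choose xs hxs hxy using hmem
  obtain ⟨x, hx, hle⟩ := BCS.exists_admissible_le_of_tendsto hV μ hT hxs
    (hy.congr fun n => (hxy n).symm)
  exact ⟨x, hx, fun z hz => hle.trans (csInf_le hbdd ⟨z, hz, rfl⟩)⟩
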